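/- Let $\mathcal A=\mathcal A_{\bar 0}\oplus\mathcal A_{\bar 1}$ be a supercommutative algebra of superfields over a field of characteristic $0$, with the odd derivation $\mathcal D_\theta=\partial_\theta+\theta\partial_x$ and the derivations $\partial/\partial t_l$ (even) and $D_n=\partial/\partial\theta_n-\sum_{k\ge1}\theta_k\,\partial/\partial t_{n+k-1}$ (odd), $l,n\ge 1$, which (anti)commute with $\mathcal D_\theta$ and with each other except for $\{D_k,D_l\}=-2\,\partial/\partial t_{k+l-1}$; here $t_1\equiv x$, so that $\partial/\partial t_1=\mathcal D_\theta^2$. (Only these relations are used; any such algebra and derivations are allowed.) Consider super-pseudo-differential operators $\sum_{j\le N}a_j\mathcal D^j$ over $\mathcal A$, where $\mathcal D f=\mathcal D_\theta(f)+(-1)^{|f|}f\mathcal D$ and $\partial=\mathcal D^2$; $(\cdot)_\pm$ are the parts with $j\ge0$ and $j<0$; $\mathcal Res$ is the coefficient of $\mathcal D^{-1}$; conjugation is given by $(a\mathcal D^j)^*=(-1)^{|a|j}(-1)^{j(j+1)/2}\mathcal D^j a$; derivations (anti)commuting with $\mathcal D_\theta$ act on operators coefficientwise. Let $\mathcal W=1+\sum_{j\ge1}(\alpha_j\partial^{-j}\mathcal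 D+\beta_j\partial^{-j})$ be even and satisfy the Manin--Radul super-KP (MR-SKP) equations $$\frac{\partial \mathcal W}{\partial t_l}=-(\mathcal W\partial^l\mathcal W^{-1})_-\mathcal W,\qquad D_n\mathcal W=-(\mathcal W\mathcal D^{2n-1}\mathcal W^{-1})_-\mathcal W ,$$ and put $\mathcal L=\mathcal W\mathcal D\mathcal W^{-1}$. For $j\ge0$ let $\Phi_{j/2},\Psi_{j/2}$ be super-eigenfunctions and adjoint super-eigenfunctions, bosonic for $j$ even and fermionic for $j$ odd: $$\tfrac{\partial}{\partial t_l}\Phi=\mathcal L^{2l}_+(\Phi),\quad D_n\Phi=\mathcal L^{2n-1}_+(\Phi),\quad \tfrac{\partial}{\partial t_l}\Psi=-(\mathcal L^{2l})^*_+(\Psi),\quad D_n\Psi=-(\mathcal L^{2n-1})^*_+(\Psi).$$ Let $R_{k,j}=\mathcal D_\theta^{-1}(\Psi_{k/2}\Phi_{j/2})$ be chosen of parity $k+j+1$ with $\mathcal D_\theta R_{k,j}=\Psi_{k/2}\Phi_{j/2}$, and put $\mathcal D_\theta^{-1}(\Phi_{j/2}\Psi_{k/2})=(-1)^{jk}R_{k,j}$.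 For $s\ge1$ let $$\mathcal M_{s/2}=\sum_{k=0}^{s-1}\Phi_{\frac{s-1-k}2}\mathcal D^{-1}\Psi_{\frac k2},\qquad \mathcal M_{s/2}(\Phi_{\frac l2})=\sum_{k=0}^{s-1}\Phi_{\frac{s-1-k}2}\,\mathcal D_\theta^{-1}\big(\Psi_{\frac k2}\Phi_{\frac l2}\big),$$ $$\mathcal M^*_{s/2}(\Psi_{\frac l2})=\sum_{k=0}^{s-1}(-1)^{jk+j+k}\,\Psi_{\frac k2}\,\mathcal D_\theta^{-1}\big(\Phi_{\frac j2}\Psi_{\frac l2}\big)\quad\text{with } j=s-1-k .$$ Let the ghost flows $\bar\partial_{s/2}$, $s\ge1$, be superderivations of $\mathcal A$ of parity $s$, (anti)commuting with $\mathcal D_\theta$, with $$\bar\partial_{s/2}\mathcal W=\mathcal M_{s/2}\mathcal W,\quad \bar\partial_{s/2}\Phi_{\frac l2}=\mathcal M_{s/2}(\Phi_{\frac l2})-\Phi_{\frac{s+l}2},\quad \bar\partial_{s/2}\Psi_{\frac l2}=-\mathcal M^*_{s/2}(\Psi_{\frac l2})+(-1)^{sl}\Psi_{\frac{s+l}2},$$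 and write $\partial/\partial\bar t_k=\bar\partial_k$, $\bar D_n=\bar\partial_{n-1/2}$. Then, for all indices $\ge1$: (a) On $\mathcal W$ and $\mathcal L$ (coefficientwise) the ghost flows (anti)commute with the MR-SKP flows, $$\Big[\frac{\partial}{\partial\bar t_s},\frac{\partial}{\partial t_l}\Big]=\Big[\frac{\partial}{\partial\bar t_s},D_n\Big]=\Big[\bar D_s,\frac{\partial}{\partial t_l}\Big]=\{\bar D_s,D_n\}=0,$$ and among themselves they satisfy $$\Big[\frac{\partial}{\partial\bar t_s},\frac{\partial}{\partial\bar t_k}\Big]=\Big[\frac{\partial}{\partial\bar t_s},\bar D_n\Big]=0,\qquad \{\bar D_i,\bar D_j\}=-2\frac{\partial}{\partial\bar t_{i+j-1}} .$$ (b) The operators $\mathcal M_{s/2}$ satisfy the equations $$\frac{\partial}{\partial t_k}\mathcal M_{s/2}=[\mathcal L^{2k}_+,\mathcal M_{s/2}]_-,\quad D_n\mathcal M_k=[\mathcal L^{2n-1}_+,\mathcal M_k]_-,\quad D_n\mathcal M_{k-\frac12}=\{\mathcal L^{2n-1}_+,\mathcal M_{k-\frac12}\}_-,$$ $$\frac{\partial}{\partial\bar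 t_k}\mathcal M_l-\frac{\partial}{\partial\bar t_l}\mathcal M_k-[\mathcal M_k,\mathcal M_l]=0,\qquad \frac{\partial}{\partial\bar t_k}\mathcal M_{l-\frac12}-\bar D_l\mathcal M_k-[\mathcal M_k,\mathcal M_{l-\frac12}]=0,$$ $$\bar D_k\mathcal M_{l-\frac12}+\bar D_l\mathcal M_{k-\frac12}-\{\mathcal M_{k-\frac12},\mathcal M_{l-\frac12}\}=-2\mathcal M_{k+l-1}.$$ (c) If the integration constants in the $R_{k,j}$ are such that $\frac{\partial}{\partial t_l}R_{k,j}=\mathcal Res(\mathcal D^{-1}\Psi_{k/2}\mathcal L^{2l}\Phi_{j/2}\mathcal D^{-1})$ and $D_nR_{k,j}=(-1)^{k+1}\mathcal Res(\mathcal D^{-1}\Psi_{k/2}\mathcal L^{2n-1}\Phi_{j/2}\mathcal D^{-1})$, then the ghost flows (anti)commute with the MR-SKP flows also on all $\Phi_{j/2},\Psi_{j/2}$. If $\bar\partial_{s/2}R_{k,j}=(-1)^{s(k+1)}\big(\sum_{m=0}^{s-1}R_{k,s-1-m}R_{m,j}-R_{k,s+j}+R_{s+k,j}\big)$, then the ghost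 flows satisfy the algebra in (a) among themselves also on all $\Phi_{j/2},\Psi_{j/2}$. -/

import Mathlib

noncomputable section

/-- The Koszul sign `(-1)^(i j)` of two parities. -/
def koszul (i j : ZMod 2) : ℤ := (-1) ^ (i.val * j.val)

/-- `d` is a (left) superderivation of parity `p` of the `ℤ/2`-graded algebra `A = 𝒢 0 ⊕ 𝒢 1`:
it shifts parities by `p` and `d (a b) = (d a) b + (-1)^(p |a|) a (d b)`. -/
structure IsSuperDerivation {𝕜 A : Type*} [Field 𝕜] [Ring A] [Algebra 𝕜 A]
    (𝒢 : ZMod 2 → Submodule 𝕜 A) (p : ZMod 2) (d : Module.End 𝕜 A) : Prop where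
  map_mem : ∀ (i : ZMod 2) (a : A), a ∈ 𝒢 i → d a ∈ 𝒢 (i + p)
  leibniz : ∀ (i : ZMod 2) (a b : A), a ∈ 𝒢 i → d (a * b) = d a * b + koszul p i • (a * d b)

/-- An algebra of superfields: a supercommutative algebra `A = 𝒢 0 ⊕ 𝒢 1` (bosonic and fermionic
superfields) with the odd derivation `Dθ = ∂/∂θ + θ ∂/∂x`, the even derivations `dt l = ∂/∂t_l` and
the odd derivations `dD n = D_n = ∂/∂θ_n - ∑ θ_k ∂/∂t_(n+k-1)` (indices `l, n ≥ 1`), subject to the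
relations of these vector fields on superspace, where `t_1` is identified with `x`, so that
`∂/∂t_1 = ∂_x = Dθ ^ 2`. -/
structure Superspace {𝕜 A : Type*} [Field 𝕜] [Ring A] [Algebra 𝕜 A]
    (𝒢 : ZMod 2 → Submodule 𝕜 A) where
  supercomm : ∀ (i j : ZMod 2) (a b : A), a ∈ 𝒢 i → b ∈ 𝒢 j → a * b = koszul i j • (b * a)
  Dθ : Module.End 𝕜 A
  dt : ℕ → Module.End 𝕜 A
  dD : ℕ → Module.End 𝕜 A
  Dθ_der : IsSuperDerivation 𝒢 1 Dθ
  dt_der : ∀ l, 1 ≤ l → IsSuperDerivation 𝒢 0 (dt l)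
  dD_der : ∀ n, 1 ≤ n → IsSuperDerivation 𝒢 1 (dD n)
  dt_Dθ : ∀ l, 1 ≤ l → dt l * Dθ = Dθ * dt l
  dD_Dθ : ∀ n, 1 ≤ n → dD n * Dθ = - (Dθ * dD n)
  dt_dt : ∀ k l, 1 ≤ k → 1 ≤ l → dt k * dt l = dt l * dt k
  dt_dD : ∀ k n, 1 ≤ k → 1 ≤ n → dt k * dD n = dD n * dt k
  dD_dD : ∀ k l, 1 ≤ k → 1 ≤ l → dD k * dD l + dD l * dD k = - (2 : 𝕜) • dt (k + l - 1)
  dt_one : dt 1 = Dθ * Dθ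

/-- The coefficients `a_n` of `𝒟^n` in a formal series bounded above in the order `n`. -/
def boundedAbove (A : Type*) [AddGroup A] : AddSubgroup (ℤ → A) where
  carrier := {a | ∃ N : ℤ, ∀ n, N < n → a n = 0}
  zero_mem' := ⟨0, fun _ _ => rfl⟩
  add_mem' := by
    rintro a b ⟨N, hN⟩ ⟨M, hM⟩
    refine ⟨max N M, fun n hn => ?_⟩
    simp [hN n (lt_of_le_of_lt (le_max_left _ _) hn), hM n (lt_of_le_of_lt (le_max_right _ _) hn)]
  neg_mem' := by
    rintro a ⟨N, hN⟩
    exact ⟨N, fun n hn => by simp [hN n hn]⟩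

/-- Super-pseudo-differential operators `∑_(n ≤ N) a_n 𝒟^n` with superfield coefficients. -/
def SPDO {𝕜 A : Type*} [Field 𝕜] [Ring A] [Algebra 𝕜 A] {𝒢 : ZMod 2 → Submodule 𝕜 A}
    (_S : Superspace 𝒢) : Type _ := boundedAbove A

/-- The super-binomial coefficients in `𝒟^i b = ∑_k [i, k] (-1)^(|b| (i-k)) (Dθ^k b) 𝒟^(i-k)`. -/
def superBinom (i : ℤ) (k : ℕ) : ℤ :=
  if Even i ∧ Odd k then 0 else Ring.choose (i / 2) (k / 2)

/-- The sign twist `a ↦ (-1)^(n |a|) a`. -/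
def twist {𝕜 A : Type*} [Field 𝕜] [Ring A] [Algebra 𝕜 A] (𝒢 : ZMod 2 → Submodule 𝕜 A)
    [GradedAlgebra 𝒢] (n : ℤ) (a : A) : A :=
  if Even n then a
  else (DirectSum.decompose 𝒢 a 0 : A) - (DirectSum.decompose 𝒢 a 1 : A)

theorem twist_zero {𝕜 A : Type*} [Field 𝕜] [Ring A] [Algebra 𝕜 A]
    (𝒢 : ZMod 2 → Submodule 𝕜 A) [GradedAlgebra 𝒢] (n : ℤ) : twist 𝒢 n (0 : A) = 0 := by
  simp [twist]

namespace SPDO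

instance {𝕜 A : Type*} [Field 𝕜] [Ring A] [Algebra 𝕜 A] {𝒢 : ZMod 2 → Submodule 𝕜 A}
    (S : Superspace 𝒢) : AddCommGroup (SPDO S) :=
  inferInstanceAs (AddCommGroup (boundedAbove A))

/-- The coefficient of `𝒟^n`. -/
def coeff {𝕜 A : Type*} [Field 𝕜] [Ring A] [Algebra 𝕜 A] {𝒢 : ZMod 2 → Submodule 𝕜 A}
    {S : Superspace 𝒢} (P : SPDO S) (n : ℤ) : A := P.1 n

/-- The monomial `f 𝒟^n`. -/
def monomial {𝕜 A : Type*} [Field 𝕜] [Ring A] [Algebra 𝕜 A] {𝒢 : ZMod 2 → Submodule 𝕜 A}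
    (S : Superspace 𝒢) (f : A) (n : ℤ) : SPDO S :=
  ⟨Pi.single n f, n, fun m hm => by simp [ne_of_gt hm]⟩

/-- The power `𝒟^n`, for any integer `n`; `𝒟^(2l) = ∂^l`. -/
def dpow {𝕜 A : Type*} [Field 𝕜] [Ring A] [Algebra 𝕜 A] {𝒢 : ZMod 2 → Submodule 𝕜 A}
    (S : Superspace 𝒢) (n : ℤ) : SPDO S := monomial S 1 n

/-- The operator of multiplication by the superfield `f`. -/
def C {𝕜 A : Type*} [Field 𝕜] [Ring A] [Algebra 𝕜 A] {𝒢 : ZMod 2 → Submodule 𝕜 A}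
    (S : Superspace 𝒢) (f : A) : SPDO S := monomial S f 0

instance {𝕜 A : Type*} [Field 𝕜] [Ring A] [Algebra 𝕜 A] {𝒢 : ZMod 2 → Submodule 𝕜 A}
    (S : Superspace 𝒢) : One (SPDO S) := ⟨monomial S 1 0⟩

/-- The coefficient of `𝒟^n` in the product `P Q`: by
`a 𝒟^i b 𝒟^j = ∑_k [i, k] (-1)^(|b| (i-k)) a (Dθ^k b) 𝒟^(i+j-k)` it is the (finite) sum over
`i` and `k` of the terms with `j = n + k - i`. -/
def mulCoeff {𝕜 A : Type*} [Field 𝕜] [Ring A] [Algebra 𝕜 A] {𝒢 : ZMod 2 → Submodule 𝕜 A}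
    [GradedAlgebra 𝒢] {S : Superspace 𝒢} (P Q : SPDO S) (n : ℤ) : A :=
  ∑ᶠ p : ℤ × ℕ, superBinom p.1 p.2 •
    (P.coeff p.1 * (S.Dθ ^ p.2) (twist 𝒢 (p.1 - p.2) (Q.coeff (n + p.2 - p.1))))

theorem mulCoeff_eq_zero {𝕜 A : Type*} [Field 𝕜] [Ring A] [Algebra 𝕜 A]
    {𝒢 : ZMod 2 → Submodule 𝕜 A} [GradedAlgebra 𝒢] {S : Superspace 𝒢} (P Q : SPDO S) (N M : ℤ)
    (hP : ∀ n, N < n → P.coeff n = 0) (hQ : ∀ n, M < n → Q.coeff n = 0) (n : ℤ)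
    (hn : N + M < n) : mulCoeff P Q n = 0 := by
  have h : ∀ p : ℤ × ℕ, superBinom p.1 p.2 •
      (P.coeff p.1 * (S.Dθ ^ p.2) (twist 𝒢 (p.1 - p.2) (Q.coeff (n + p.2 - p.1)))) = 0 := by
    rintro ⟨i, k⟩
    by_cases hi : N < i
    · simp [hP i hi]
    · have : Q.coeff (n + k - i) = 0 := hQ _ (by omega)
      simp [this, twist_zero]
  simp only [mulCoeff, h, finsum_zero]

instance {𝕜 A : Type*} [Field 𝕜] [Ring A] [Algebra 𝕜 A] {𝒢 : ZMod 2 → Submodule 𝕜 A}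
    [GradedAlgebra 𝒢] (S : Superspace 𝒢) : Mul (SPDO S) :=
  ⟨fun P Q => ⟨mulCoeff P Q, by
    obtain ⟨N, hN⟩ := P.2
    obtain ⟨M, hM⟩ := Q.2
    exact ⟨N + M, mulCoeff_eq_zero P Q N M hN hM⟩⟩⟩

/-- Powers with exponents in `ℕ`: `P ^ 0 = 1` and `P ^ (n + 1) = P ^ n * P`. -/
instance {𝕜 A : Type*} [Field 𝕜] [Ring A] [Algebra 𝕜 A] {𝒢 : ZMod 2 → Submodule 𝕜 A}
    [GradedAlgebra 𝒢] (S : Superspace 𝒢) : Pow (SPDO S) ℕ := ⟨fun P n => npowRec n P⟩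

/-- The purely differential part `P_+`. -/
def pos {𝕜 A : Type*} [Field 𝕜] [Ring A] [Algebra 𝕜 A] {𝒢 : ZMod 2 → Submodule 𝕜 A}
    {S : Superspace 𝒢} (P : SPDO S) : SPDO S :=
  ⟨fun n => if 0 ≤ n then P.coeff n else 0, by
    obtain ⟨N, hN⟩ := P.2
    exact ⟨N, fun n hn => by simp [coeff, hN n hn]⟩⟩

/-- The purely pseudo-differential part `P_-`. -/
def neg {𝕜 A : Type*} [Field 𝕜] [Ring A] [Algebra 𝕜 A] {𝒢 : ZMod 2 → Submodule 𝕜 A}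
    {S : Superspace 𝒢} (P : SPDO S) : SPDO S :=
  ⟨fun n => if n < 0 then P.coeff n else 0, by
    obtain ⟨N, hN⟩ := P.2
    exact ⟨N, fun n hn => by simp [coeff, hN n hn]⟩⟩

/-- The super-residue, the coefficient of `𝒟^(-1)`. -/
def res {𝕜 A : Type*} [Field 𝕜] [Ring A] [Algebra 𝕜 A] {𝒢 : ZMod 2 → Submodule 𝕜 A}
    {S : Superspace 𝒢} (P : SPDO S) : A := P.coeff (-1)

/-- The conjugate `P^*`, by `(a 𝒟^j)^* = (-1)^(|a| j) (𝒟^j)^* a` and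
`(𝒟^j)^* = (-1)^(j (j+1) / 2) 𝒟^j`. -/
def adj {𝕜 A : Type*} [Field 𝕜] [Ring A] [Algebra 𝕜 A] {𝒢 : ZMod 2 → Submodule 𝕜 A}
    [GradedAlgebra 𝒢] {S : Superspace 𝒢} (P : SPDO S) : SPDO S :=
  ⟨fun n => ∑ᶠ j : ℤ, ((j * (j + 1) / 2).negOnePow : ℤ) •
      (dpow S j * C S (twist 𝒢 j (P.coeff j))).coeff n, by
    obtain ⟨N, hN⟩ := P.2
    refine ⟨N, fun n hn => ?_⟩
    have h : ∀ j : ℤ, ((j * (j + 1) / 2).negOnePow : ℤ) •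
        (dpow S j * C S (twist 𝒢 j (P.coeff j))).coeff n = 0 := by
      intro j
      have h0 : (dpow S j * C S (twist 𝒢 j (P.coeff j))).coeff n = 0 := by
        by_cases hj : N < j
        · have hz : P.coeff j = 0 := hN j hj
          refine mulCoeff_eq_zero _ _ j (n - j - 1) (fun m hm => ?_) (fun m _ => ?_) n (by omega)
          · simp [dpow, monomial, coeff, ne_of_gt hm]
          · rw [hz, twist_zero]
            simp [C, monomial, coeff]
        · refine mulCoeff_eq_zero _ _ j 0 (fun m hm => ?_) (fun m hm => ?_) n (by omega)
          · simp [dpow, monomial, coeff, ne_of_gt hm]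
          · simp [C, monomial, coeff, ne_of_gt hm]
      rw [h0, smul_zero]
    simp only [h, finsum_zero]⟩

/-- The action `P_+ (f)` of the differential part of `P` on the superfield `f`. -/
def applyPos {𝕜 A : Type*} [Field 𝕜] [Ring A] [Algebra 𝕜 A] {𝒢 : ZMod 2 → Submodule 𝕜 A}
    {S : Superspace 𝒢} (P : SPDO S) (f : A) : A :=
  ∑ᶠ j : ℕ, P.coeff j * (S.Dθ ^ j) f

/-- The action of a linear map on the coefficients of `P`. A flow that (anti)commutes with `Dθ`
acts on operators in this way. -/
def map {𝕜 A : Type*} [Field 𝕜] [Ring A] [Algebra 𝕜 A] {𝒢 : ZMod 2 → Submodule 𝕜 A}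
    {S : Superspace 𝒢} (d : Module.End 𝕜 A) (P : SPDO S) : SPDO S :=
  ⟨fun n => d (P.coeff n), by
    obtain ⟨N, hN⟩ := P.2
    exact ⟨N, fun n hn => by simp [coeff, hN n hn]⟩⟩

/-- The commutator. -/
def comm {𝕜 A : Type*} [Field 𝕜] [Ring A] [Algebra 𝕜 A] {𝒢 : ZMod 2 → Submodule 𝕜 A}
    [GradedAlgebra 𝒢] {S : Superspace 𝒢} (P Q : SPDO S) : SPDO S := P * Q - Q * P

/-- The anticommutator. -/
def anticomm {𝕜 A : Type*} [Field 𝕜] [Ring A] [Algebra 𝕜 A] {𝒢 : ZMod 2 → Submodule 𝕜 A}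
    [GradedAlgebra 𝒢] {S : Superspace 𝒢} (P Q : SPDO S) : SPDO S := P * Q + Q * P

end SPDO

open SPDO

/-- The Lax operator `L = W 𝒟 W⁻¹` (with `V` the inverse of `W`). -/
def laxOp {𝕜 A : Type*} [Field 𝕜] [Ring A] [Algebra 𝕜 A] {𝒢 : ZMod 2 → Submodule 𝕜 A}
    [GradedAlgebra 𝒢] {S : Superspace 𝒢} (W V : SPDO S) : SPDO S := W * dpow S 1 * V

/-- `W = 1 + ∑_(j ≥ 1) (α_j ∂^(-j) 𝒟 + β_j ∂^(-j))` is a bosonic dressing operator with inverse `V`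
that solves the Manin-Radul super-KP hierarchy. -/
structure IsMRSKP {𝕜 A : Type*} [Field 𝕜] [Ring A] [Algebra 𝕜 A] {𝒢 : ZMod 2 → Submodule 𝕜 A}
    [GradedAlgebra 𝒢] {S : Superspace 𝒢} (W V : SPDO S) : Prop where
  coeff_zero : W.coeff 0 = 1
  coeff_pos : ∀ n, 0 < n → W.coeff n = 0
  bosonic : ∀ n : ℤ, W.coeff n ∈ 𝒢 n
  mul_inv : W * V = 1
  inv_mul : V * W = 1
  dt_eq : ∀ l, 1 ≤ l → W.map (S.dt l) = - ((W * dpow S (2 * l) * V).neg * W)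
  dD_eq : ∀ n, 1 ≤ n → W.map (S.dD n) = - ((W * dpow S (2 * n - 1) * V).neg * W)

/-- `Φ` is a super-eigenfunction of `L`, of parity `p`. -/
structure IsSEF {𝕜 A : Type*} [Field 𝕜] [Ring A] [Algebra 𝕜 A] {𝒢 : ZMod 2 → Submodule 𝕜 A}
    [GradedAlgebra 𝒢] {S : Superspace 𝒢} (L : SPDO S) (p : ZMod 2) (Φ : A) : Prop where
  parity : Φ ∈ 𝒢 p
  dt_eq : ∀ l, 1 ≤ l → S.dt l Φ = (L ^ (2 * l)).applyPos Φ
  dD_eq : ∀ n, 1 ≤ n → S.dD n Φ = (L ^ (2 * n - 1)).applyPos Φ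

/-- `Ψ` is an adjoint super-eigenfunction of `L`, of parity `p`. -/
structure IsAdjSEF {𝕜 A : Type*} [Field 𝕜] [Ring A] [Algebra 𝕜 A] {𝒢 : ZMod 2 → Submodule 𝕜 A}
    [GradedAlgebra 𝒢] {S : Superspace 𝒢} (L : SPDO S) (p : ZMod 2) (Ψ : A) : Prop where
  parity : Ψ ∈ 𝒢 p
  dt_eq : ∀ l, 1 ≤ l → S.dt l Ψ = - (adj (L ^ (2 * l))).applyPos Ψ
  dD_eq : ∀ n, 1 ≤ n → S.dD n Ψ = - (adj (L ^ (2 * n - 1))).applyPos Ψ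

/-- `R k j` is a choice of the inverse derivative `Dθ⁻¹ (Ψ_(k/2) Φ_(j/2))`, the super squared
eigenfunction potential. Here and below `Φ j`, `Ψ j` stand for `Φ_(j/2)`, `Ψ_(j/2)`. -/
structure IsSEP {𝕜 A : Type*} [Field 𝕜] [Ring A] [Algebra 𝕜 A] {𝒢 : ZMod 2 → Submodule 𝕜 A}
    (S : Superspace 𝒢) (Φ Ψ : ℕ → A) (R : ℕ → ℕ → A) : Prop where
  parity : ∀ k j : ℕ, R k j ∈ 𝒢 (k + j + 1)
  Dθ_eq : ∀ k j : ℕ, S.Dθ (R k j) = Ψ k * Φ j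

/-- `M_(s/2) = ∑_(k=0)^(s-1) Φ_((s-1-k)/2) 𝒟⁻¹ Ψ_(k/2)`. -/
def ghostOp {𝕜 A : Type*} [Field 𝕜] [Ring A] [Algebra 𝕜 A] {𝒢 : ZMod 2 → Submodule 𝕜 A}
    [GradedAlgebra 𝒢] (S : Superspace 𝒢) (Φ Ψ : ℕ → A) (s : ℕ) : SPDO S :=
  ∑ k ∈ Finset.range s, C S (Φ (s - 1 - k)) * dpow S (-1) * C S (Ψ k)

/-- `M_(s/2) (Φ_(l/2)) = ∑_k Φ_((s-1-k)/2) Dθ⁻¹ (Ψ_(k/2) Φ_(l/2))`. -/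
def ghostApply {A : Type*} [Ring A] (Φ : ℕ → A) (R : ℕ → ℕ → A) (s l : ℕ) : A :=
  ∑ k ∈ Finset.range s, Φ (s - 1 - k) * R k l

/-- `M^*_(s/2) (Ψ_(l/2))`, where `(Φ_(j/2) 𝒟⁻¹ Ψ_(k/2))^* = (-1)^(jk+j+k) Ψ_(k/2) 𝒟⁻¹ Φ_(j/2)` by
the rules of conjugation, and `Dθ⁻¹ (Φ_(j/2) Ψ_(l/2)) = (-1)^(jl) Dθ⁻¹ (Ψ_(l/2) Φ_(j/2))`. -/
def ghostAdjApply {A : Type*} [Ring A] (Ψ : ℕ → A) (R : ℕ → ℕ → A) (s l : ℕ) : A :=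
  ∑ k ∈ Finset.range s, (-1 : ℤ) ^ ((s - 1 - k) * k + (s - 1 - k) + k) •
    (Ψ k * ((-1 : ℤ) ^ ((s - 1 - k) * l) • R l (s - 1 - k)))

/-- `g s` is the ghost flow `∂̄_(s/2)`, `s ≥ 1`, that is `∂/∂t̄_k` for `s = 2k` and `D̄_n` for
`s = 2n - 1`: a superderivation of parity `s` that (anti)commutes with `Dθ` and acts on the dressing
operator and, non-homogeneously, on the (adjoint) eigenfunctions by the formulas below. -/
structure IsGhostFlow {𝕜 A : Type*} [Field 𝕜] [Ring A] [Algebra 𝕜 A]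
    {𝒢 : ZMod 2 → Submodule 𝕜 A} [GradedAlgebra 𝒢] {S : Superspace 𝒢} (W : SPDO S) (Φ Ψ : ℕ → A)
    (R : ℕ → ℕ → A) (g : ℕ → Module.End 𝕜 A) : Prop where
  der : ∀ s : ℕ, 1 ≤ s → IsSuperDerivation 𝒢 s (g s)
  comm_Dθ : ∀ s, 1 ≤ s → g s * S.Dθ = (-1 : ℤ) ^ s • (S.Dθ * g s)
  dressing : ∀ s, 1 ≤ s → W.map (g s) = ghostOp S Φ Ψ s * W
  eigen : ∀ s l, 1 ≤ s → g s (Φ l) = ghostApply Φ R s l - Φ (s + l)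
  adjEigen : ∀ s l, 1 ≤ s →
    g s (Ψ l) = - ghostAdjApply Ψ R s l + (-1 : ℤ) ^ (s * l) • Ψ (s + l)

/-- The ghost flows (anti)commute with the Manin-Radul flows; `Z f` says that the operator `f`, a
(anti)commutator of flows, vanishes on the fields under consideration. -/
structure GhostCommute {𝕜 A : Type*} [Field 𝕜] [Ring A] [Algebra 𝕜 A]
    {𝒢 : ZMod 2 → Submodule 𝕜 A} (S : Superspace 𝒢) (g : ℕ → Module.End 𝕜 A)
    (Z : Module.End 𝕜 A → Prop) : Prop where
  even_even : ∀ k l, 1 ≤ k → 1 ≤ l → Z (g (2 * k) * S.dt l - S.dt l * g (2 * k))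
  even_odd : ∀ k n, 1 ≤ k → 1 ≤ n → Z (g (2 * k) * S.dD n - S.dD n * g (2 * k))
  odd_even : ∀ k l, 1 ≤ k → 1 ≤ l → Z (g (2 * k - 1) * S.dt l - S.dt l * g (2 * k - 1))
  odd_odd : ∀ k n, 1 ≤ k → 1 ≤ n → Z (g (2 * k - 1) * S.dD n + S.dD n * g (2 * k - 1))

/-- The algebra of the ghost flows, with `Z` as above. -/
structure GhostAlgebra {𝕜 A : Type*} [Field 𝕜] [Ring A] [Algebra 𝕜 A]
    (g : ℕ → Module.End 𝕜 A) (Z : Module.End 𝕜 A → Prop) : Prop where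
  even_even : ∀ k l, 1 ≤ k → 1 ≤ l → Z (g (2 * k) * g (2 * l) - g (2 * l) * g (2 * k))
  even_odd : ∀ k n, 1 ≤ k → 1 ≤ n → Z (g (2 * k) * g (2 * n - 1) - g (2 * n - 1) * g (2 * k))
  odd_odd : ∀ i j, 1 ≤ i → 1 ≤ j →
    Z ((g (2 * i - 1) * g (2 * j - 1) + g (2 * j - 1) * g (2 * i - 1))
      - (- (2 : 𝕜) • g (2 * (i + j - 1))))

/-- The evolution of the potentials `R k j = Dθ⁻¹ (Ψ_(k/2) Φ_(j/2))` along the Manin-Radul flows. -/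
structure SEPEvolves {𝕜 A : Type*} [Field 𝕜] [Ring A] [Algebra 𝕜 A]
    {𝒢 : ZMod 2 → Submodule 𝕜 A} [GradedAlgebra 𝒢] {S : Superspace 𝒢} (L : SPDO S) (Φ Ψ : ℕ → A)
    (R : ℕ → ℕ → A) : Prop where
  dt_eq : ∀ k j l, 1 ≤ l → S.dt l (R k j) =
    res (dpow S (-1) * C S (Ψ k) * L ^ (2 * l) * C S (Φ j) * dpow S (-1))
  dD_eq : ∀ k j n, 1 ≤ n → S.dD n (R k j) = (-1 : ℤ) ^ (k + 1) •
    res (dpow S (-1) * C S (Ψ k) * L ^ (2 * n - 1) * C S (Φ j) * dpow S (-1))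

/-- The evolution of the potentials along the ghost flows. Applying `Dθ` to both sides gives an
identity, so that this only fixes the `Dθ`-constants. -/
def SEPGhostEvolves {𝕜 A : Type*} [Field 𝕜] [Ring A] [Algebra 𝕜 A]
    (R : ℕ → ℕ → A) (g : ℕ → Module.End 𝕜 A) : Prop :=
  ∀ s k j, 1 ≤ s → g s (R k j) = (-1 : ℤ) ^ (s * (k + 1)) •
    (∑ m ∈ Finset.range s, R k (s - 1 - m) * R m j - R k (s + j) + R (s + k) j)

end

/-! Signs are carried by the grading involution `gradeInv` and its operator version `parityInv`, and
each hierarchy is indexed by a single integer whose parity is that of the flow (`mrFlow S m`, `g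
s`). Every relation then becomes one supercommutator with sign `(-1)^(s m)` or `(-1)^(s t)`.

If two flows act by `d W = X W` and `d' W = Y W`, their bracket acts by `(d Y ∓ d' X - [X, Y]) W`
(`map_bracket`), so on `W` everything reduces to zero-curvature equations. Such a bracket is again a
superderivation compatible with `Dθ`. When it kills `W` it therefore kills `L = W 𝒟 W⁻¹`.

Ghost flow against Manin-Radul flow: here `X = M_s` and `Y = -(L^m)_-`. For a differential operator
`B`, `(B a 𝒟⁻¹ b)_- = B(a) 𝒟⁻¹ b`, and dually on the right. The eigenfunction equations thus give `∂
M_s = [L^m_+, M_s]_-` (`map_mrFlow_ghostOp`), and curvature vanishes because `M_s` and `(L^m)_-`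
have negative order.

Ghost flow against ghost flow: integration by parts, `𝒟⁻¹ (Dθ r) 𝒟⁻¹ = r 𝒟⁻¹ - 𝒟⁻¹ (-1)^|r| r`,
expresses `M_s M_t` through `M_s(Φ)` and `M_t^*(Ψ)` (`ghostOp_mul_ghostOp`). These cancel the
homogeneous parts of the ghost flows. The index shifts `Φ_(s+l)`, `Ψ_(s+l)` that remain fit together
into `((-1)^(s t) - 1) M_(s+t)` (`ghostFlow_zero_curvature`), which is zero unless both flows are
odd and is then `-2 M_(s+t)`.

On the eigenfunctions the action of a differential operator is rewritten as a residue, and the same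
integration by parts applies. What is left over is exactly a derivative of the potentials `R`, hence
the normalization assumptions in (c).

All this needs the operators to form a ring. Associativity is proved for left multiplication by `𝒟`
from Pascal's rule, passes to negative powers since `𝒟` can be cancelled, and extends to all series
because products are determined by monomials up to arbitrarily low order. -/

noncomputable section

/-! ### Coefficients and the order filtration of formal operators. -/

namespace SPDO

variable {𝕜 A : Type*} [Field 𝕜] [Ring A] [Algebra 𝕜 A] {𝒢 : ZMod 2 → Submodule 𝕜 A}
  {S : Superspace 𝒢}

@[ext] theorem ext {P Q : SPDO S} (h : ∀ n, P.coeff n = Q.coeff n) : P = Q :=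
  Subtype.ext (funext h)

@[simp] theorem coeff_zero (n : ℤ) : (0 : SPDO S).coeff n = 0 := rfl
@[simp] theorem coeff_add (P Q : SPDO S) (n : ℤ) : (P + Q).coeff n = P.coeff n + Q.coeff n := rfl
@[simp] theorem coeff_neg (P : SPDO S) (n : ℤ) : (-P).coeff n = -P.coeff n := rfl
@[simp] theorem coeff_sub (P Q : SPDO S) (n : ℤ) : (P - Q).coeff n = P.coeff n - Q.coeff n := rfl

/-- Taking a coefficient is additive. -/
def coeffHom (S : Superspace 𝒢) (n : ℤ) : SPDO S →+ A where
  toFun P := P.coeff n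
  map_zero' := rfl
  map_add' _ _ := rfl

@[simp] theorem coeff_zsmul (z : ℤ) (P : SPDO S) (n : ℤ) : (z • P).coeff n = z • P.coeff n :=
  map_zsmul (coeffHom S n) z P

@[simp] theorem coeff_sum {ι : Type*} (s : Finset ι) (f : ι → SPDO S) (n : ℤ) :
    (∑ i ∈ s, f i).coeff n = ∑ i ∈ s, (f i).coeff n :=
  map_sum (coeffHom S n) f s

theorem coeff_monomial (f : A) (m n : ℤ) :
    (monomial S f m).coeff n = if n = m then f else 0 := by
  simp [monomial, coeff, Pi.single_apply]

theorem coeff_dpow (m n : ℤ) : (dpow S m).coeff n = if n = m then 1 else 0 :=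
  coeff_monomial _ _ _

theorem coeff_C (f : A) (n : ℤ) : (C S f).coeff n = if n = 0 then f else 0 :=
  coeff_monomial _ _ _

theorem coeff_one (n : ℤ) : (1 : SPDO S).coeff n = if n = 0 then 1 else 0 :=
  coeff_monomial _ _ _

@[simp] theorem coeff_map (d : Module.End 𝕜 A) (P : SPDO S) (n : ℤ) :
    (P.map d).coeff n = d (P.coeff n) := rfl

/-- Operators of order at most `N`. -/
def order (S : Superspace 𝒢) (N : ℤ) : AddSubgroup (SPDO S) where
  carrier := {P | ∀ n, N < n → P.coeff n = 0}
  zero_mem' := fun _ _ => rfl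
  add_mem' hP hQ n hn := by simp [hP n hn, hQ n hn]
  neg_mem' hP n hn := by simp [hP n hn]

theorem exists_mem_order (P : SPDO S) : ∃ N, P ∈ order S N := P.2

theorem order_mono {M N : ℤ} (h : M ≤ N) {P : SPDO S} (hP : P ∈ order S M) : P ∈ order S N :=
  fun n hn => hP n (by omega)

theorem monomial_mem_order (f : A) (n : ℤ) : monomial S f n ∈ order S n := fun m hm => by
  simp [coeff_monomial, ne_of_gt hm]

theorem dpow_mem_order (n : ℤ) : dpow S n ∈ order S n := monomial_mem_order 1 n

theorem C_mem_order (f : A) : C S f ∈ order S 0 := monomial_mem_order f 0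

theorem eq_zero_of_mem_order {P : SPDO S} (h : ∀ N, P ∈ order S N) : P = 0 :=
  ext fun n => h (n - 1) n (by omega)

/-- Every operator is a finite sum of monomials up to operators of low order. -/
theorem exists_sum_monomial (P : SPDO S) (K : ℤ) :
    ∃ s : Finset ℤ, P - ∑ i ∈ s, monomial S (P.coeff i) i ∈ order S K := by
  obtain ⟨N, hN⟩ := P.exists_mem_order
  refine ⟨Finset.Icc (K + 1) N, fun n hn => ?_⟩
  by_cases h : n ≤ N
  · simp [coeff_monomial, show K + 1 ≤ n by omega, h]
  · simp [coeff_monomial, h, hN n (by omega)]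

/-- Additive maps of bounded order that agree on monomials are equal. -/
theorem addHom_ext {f g : SPDO S →+ SPDO S}
    (hf : ∃ c, ∀ N P, P ∈ order S N → f P ∈ order S (N + c))
    (hg : ∃ c, ∀ N P, P ∈ order S N → g P ∈ order S (N + c))
    (h : ∀ a n, f (monomial S a n) = g (monomial S a n)) : f = g := by
  obtain ⟨c, hc⟩ := hf
  obtain ⟨d, hd⟩ := hg
  refine AddMonoidHom.ext fun P => sub_eq_zero.1 (eq_zero_of_mem_order fun N => ?_)
  obtain ⟨s, hs⟩ := exists_sum_monomial P (min (N - c) (N - d))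
  -- The monomials contribute equally to `f` and `g`, so only the remainder of low order survives.
  -- Both maps shift orders by a bounded amount, so the difference has arbitrarily low order.
  have key : f P - g P = f (P - ∑ i ∈ s, monomial S (P.coeff i) i)
      - g (P - ∑ i ∈ s, monomial S (P.coeff i) i) := by
    simp [map_sub, map_sum, h]
  rw [key]
  refine sub_mem (order_mono ?_ (hc _ _ hs)) (order_mono ?_ (hd _ _ hs))
  · have := min_le_left (N - c) (N - d); omega
  · have := min_le_right (N - c) (N - d); omega

end SPDO

/-! ### The grading involution. -/

section Twist

variable {𝕜 A : Type*} [Field 𝕜] [Ring A] [Algebra 𝕜 A] (𝒢 : ZMod 2 → Submodule 𝕜 A)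
  [GradedAlgebra 𝒢]

/-- The grading involution `a ↦ (-1)^|a| a`, as an additive map. -/
def gradeInvAdd : A →+ A where
  toFun a := (DirectSum.decompose 𝒢 a 0 : A) - (DirectSum.decompose 𝒢 a 1 : A)
  map_zero' := by simp
  map_add' a b := by
    simp only [DirectSum.decompose_add, DirectSum.add_apply, Submodule.coe_add]; abel

theorem gradeInvAdd_of_mem {i : ℕ} {a : A} (h : a ∈ 𝒢 i) :
    gradeInvAdd 𝒢 a = (-1 : ℤ) ^ i • a := by
  change (DirectSum.decompose 𝒢 a 0 : A) - (DirectSum.decompose 𝒢 a 1 : A) = _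
  rcases Nat.even_or_odd i with hi | hi
  · rw [ZMod.natCast_eq_zero_iff_even.2 hi] at h
    rw [DirectSum.decompose_of_mem_same 𝒢 h, DirectSum.decompose_of_mem_ne 𝒢 h (by decide),
      hi.neg_one_pow, one_smul, sub_zero]
  · rw [ZMod.natCast_eq_one_iff_odd.2 hi] at h
    rw [DirectSum.decompose_of_mem_same 𝒢 h, DirectSum.decompose_of_mem_ne 𝒢 h (by decide),
      hi.neg_one_pow]
    simp

/-- An induction principle: homogeneous elements with parities in `ℕ`. -/
theorem homogeneous_induction {p : A → Prop} (zero : p 0)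
    (hom : ∀ (i : ℕ) (a : A), a ∈ 𝒢 i → p a) (add : ∀ a b, p a → p b → p (a + b)) (a : A) :
    p a := by
  induction a using DirectSum.Decomposition.inductionOn 𝒢 with
  | zero => exact zero
  | @homogeneous i x => exact hom i.val x (by rw [ZMod.natCast_zmod_val]; exact x.2)
  | add a b ha hb => exact add a b ha hb

/-- The grading involution `a ↦ (-1)^|a| a`. -/
def gradeInv : A →+* A where
  __ := gradeInvAdd 𝒢
  map_one' := by
    have := gradeInvAdd_of_mem 𝒢 (i := 0) (a := (1 : A))
      (by simpa using SetLike.GradedOne.one_mem)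
    simpa using this
  map_mul' a b := by
    change gradeInvAdd 𝒢 (a * b) = gradeInvAdd 𝒢 a * gradeInvAdd 𝒢 b
    induction a using homogeneous_induction 𝒢 with
    | zero => simp
    | add x y h₁ h₂ => rw [add_mul, map_add, h₁, h₂, map_add, add_mul]
    | hom i x hx =>
      induction b using homogeneous_induction 𝒢 with
      | zero => simp
      | add x y h₁ h₂ => rw [mul_add, map_add, h₁, h₂, map_add, mul_add]
      | hom j y hy =>
        have hxy : x * y ∈ 𝒢 ((i + j : ℕ) : ZMod 2) := by
          rw [Nat.cast_add]; exact SetLike.GradedMul.mul_mem hx hy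
        rw [gradeInvAdd_of_mem 𝒢 hx, gradeInvAdd_of_mem 𝒢 hy, gradeInvAdd_of_mem 𝒢 hxy,
          smul_mul_smul_comm, pow_add]

theorem gradeInv_of_mem {i : ℕ} {a : A} (h : a ∈ 𝒢 i) : gradeInv 𝒢 a = (-1 : ℤ) ^ i • a :=
  gradeInvAdd_of_mem 𝒢 h

theorem twist_eq (n : ℤ) (a : A) : twist 𝒢 n a = if Even n then a else gradeInv 𝒢 a := rfl

theorem gradeInv_gradeInv (a : A) : gradeInv 𝒢 (gradeInv 𝒢 a) = a := by
  induction a using homogeneous_induction 𝒢 with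
  | zero => simp
  | add x y h₁ h₂ => rw [map_add, map_add, h₁, h₂]
  | hom i x hx =>
    rw [gradeInv_of_mem 𝒢 hx, map_zsmul, gradeInv_of_mem 𝒢 hx, smul_smul, ← mul_pow]
    simp

theorem twist_add (m n : ℤ) (a : A) : twist 𝒢 (m + n) a = twist 𝒢 m (twist 𝒢 n a) := by
  simp only [twist_eq, Int.even_add]
  by_cases hm : Even m <;> by_cases hn : Even n <;> simp [hm, hn, gradeInv_gradeInv]

/-- The twist as an additive map. -/
def twistHom (n : ℤ) : A →+ A where
  toFun := twist 𝒢 n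
  map_zero' := twist_zero 𝒢 n
  map_add' a b := by simp only [twist_eq]; split_ifs <;> simp

theorem twistHom_apply (n : ℤ) (a : A) : twistHom 𝒢 n a = twist 𝒢 n a := rfl

theorem twist_one_eq (a : A) : twist 𝒢 1 a = gradeInv 𝒢 a := by
  rw [twist_eq, if_neg (by decide)]

theorem twist_map_one (n : ℤ) : twist 𝒢 n (1 : A) = 1 := by
  simp [twist_eq]

end Twist

namespace Superspace

variable {𝕜 A : Type*} [Field 𝕜] [Ring A] [Algebra 𝕜 A] {𝒢 : ZMod 2 → Submodule 𝕜 A}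
  [GradedAlgebra 𝒢] (S : Superspace 𝒢)

theorem gradeInv_Dθ (a : A) : gradeInv 𝒢 (S.Dθ a) = -S.Dθ (gradeInv 𝒢 a) := by
  induction a using homogeneous_induction 𝒢 with
  | zero => simp
  | add x y h₁ h₂ => rw [map_add, map_add, h₁, h₂, map_add, map_add, neg_add]
  | hom i x hx =>
    have h : S.Dθ x ∈ 𝒢 ((i + 1 : ℕ) : ZMod 2) := by
      simpa using S.Dθ_der.map_mem _ _ hx
    rw [gradeInv_of_mem 𝒢 hx, gradeInv_of_mem 𝒢 h, map_zsmul, pow_succ]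
    simp

/-- Replacing the sign `(-1)^|a|` by the grading involution makes the Leibniz rule valid for
inhomogeneous elements, as coefficients of arbitrary operators require. -/
theorem Dθ_mul (a b : A) : S.Dθ (a * b) = S.Dθ a * b + gradeInv 𝒢 a * S.Dθ b := by
  induction a using homogeneous_induction 𝒢 with
  | zero => simp
  | add x y h₁ h₂ => rw [add_mul, map_add, h₁, h₂, map_add, map_add, add_mul, add_mul]; abel
  | hom i x hx =>
    rw [S.Dθ_der.leibniz _ _ _ hx, gradeInv_of_mem 𝒢 hx, smul_mul_assoc]
    congr 2
    rcases Nat.even_or_odd i with hi | hi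
    · rw [ZMod.natCast_eq_zero_iff_even.2 hi, hi.neg_one_pow]; rfl
    · rw [ZMod.natCast_eq_one_iff_odd.2 hi, hi.neg_one_pow]; rfl

theorem Dθ_one : S.Dθ (1 : A) = 0 := by
  have := S.Dθ_mul 1 1
  simpa using this

theorem gradeInv_Dθ_pow (k : ℕ) (a : A) :
    gradeInv 𝒢 ((S.Dθ ^ k) a) = (-1 : ℤ) ^ k • (S.Dθ ^ k) (gradeInv 𝒢 a) := by
  induction k with
  | zero => simp
  | succ k ih =>
    rw [pow_succ', pow_succ', Module.End.mul_apply, gradeInv_Dθ, ih, map_zsmul, neg_one_mul,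
      neg_smul]
    rfl

end Superspace

/-! ### Super-binomial coefficients. -/

theorem superBinom_zero_right (i : ℤ) : superBinom i 0 = 1 := by
  simp [superBinom]

theorem superBinom_zero_succ (k : ℕ) : superBinom 0 (k + 1) = 0 := by
  unfold superBinom
  split_ifs with h
  · rfl
  · have h1 : (k + 1) / 2 ≠ 0 := fun h0 => h (by
      obtain rfl : k = 0 := by omega
      simp)
    obtain ⟨m, hm⟩ := Nat.exists_eq_succ_of_ne_zero h1
    rw [hm]
    simp

theorem superBinom_two_mul_odd (p : ℤ) (q : ℕ) : superBinom (2 * p) (2 * q + 1) = 0 := by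
  simp [superBinom]

theorem superBinom_two_mul (p : ℤ) (q : ℕ) : superBinom (2 * p) (2 * q) = Ring.choose p q := by
  simp [superBinom]

theorem superBinom_odd (p : ℤ) (q : ℕ) : superBinom (2 * p + 1) (2 * q) = Ring.choose p q := by
  have h : (2 * p + 1) / 2 = p := by omega
  simp [superBinom, h]

theorem superBinom_odd_odd (p : ℤ) (q : ℕ) :
    superBinom (2 * p + 1) (2 * q + 1) = Ring.choose p q := by
  have h : (2 * p + 1) / 2 = p := by omega
  have h' : (2 * q + 1) / 2 = q := by omega
  simp [superBinom, h, h']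

/-- Pascal's rule for the super-binomial coefficients. -/
theorem superBinom_succ_succ (i : ℤ) (k : ℕ) :
    superBinom (i + 1) (k + 1) = superBinom i k + (-1) ^ (k + 1) * superBinom i (k + 1) := by
  obtain ⟨p, rfl | rfl⟩ := Int.even_or_odd' i <;> obtain ⟨q, rfl | rfl⟩ := Nat.even_or_odd' k
  · simp [superBinom_two_mul_odd, superBinom_two_mul, superBinom_odd_odd]
  · have h : 2 * q + 1 + 1 = 2 * (q + 1) := by ring
    rw [h]
    simp [superBinom_two_mul_odd, superBinom_two_mul, superBinom_odd]
  · have h : 2 * p + 1 + 1 = 2 * (p + 1) := by ring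
    rw [h]
    simp [superBinom_two_mul_odd, superBinom_odd, superBinom_odd_odd, pow_succ]
  -- The only case that needs the ordinary Pascal rule, for a possibly negative upper index.
  · have h : 2 * p + 1 + 1 = 2 * (p + 1) := by ring
    have h' : 2 * q + 1 + 1 = 2 * (q + 1) := by ring
    rw [h, h']
    simp [superBinom_two_mul, superBinom_odd, superBinom_odd_odd, Ring.choose_succ_succ]

theorem superBinom_one (k : ℕ) : superBinom 1 (k + 2) = 0 := by
  have := superBinom_succ_succ 0 (k + 1)
  simpa [superBinom_zero_succ] using this

/-- For `i ≥ 0` the expansion of `𝒟^i b` stops at `k = i`; this is what closes the differential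
operators under multiplication. -/
theorem superBinom_of_lt {i k : ℕ} (h : i < k) : superBinom i k = 0 := by
  induction i generalizing k with
  | zero => obtain ⟨k, rfl⟩ := Nat.exists_eq_succ_of_ne_zero (by omega : k ≠ 0)
            exact superBinom_zero_succ k
  | succ i ih =>
    obtain ⟨k, rfl⟩ := Nat.exists_eq_succ_of_ne_zero (by omega : k ≠ 0)
    push_cast
    rw [Nat.succ_eq_add_one, superBinom_succ_succ, ih (by omega), ih (by omega)]; simp

theorem superBinom_self (i : ℕ) : superBinom i i = 1 := by
  induction i with
  | zero => exact superBinom_zero_right _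
  | succ i ih =>
    push_cast
    rw [superBinom_succ_succ, ih, superBinom_of_lt (Nat.lt_succ_self i)]; simp

/-! ### The ring of super-pseudo-differential operators. -/

namespace SPDO

variable {𝕜 A : Type*} [Field 𝕜] [Ring A] [Algebra 𝕜 A] {𝒢 : ZMod 2 → Submodule 𝕜 A}
  [GradedAlgebra 𝒢] {S : Superspace 𝒢}

/-- The summands of a coefficient of a product. -/
def mulTerm (P Q : SPDO S) (n : ℤ) (p : ℤ × ℕ) : A := superBinom p.1 p.2 •
    (P.coeff p.1 * (S.Dθ ^ p.2) (twist 𝒢 (p.1 - p.2) (Q.coeff (n + p.2 - p.1))))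

theorem coeff_mul (P Q : SPDO S) (n : ℤ) : (P * Q).coeff n = ∑ᶠ p, mulTerm P Q n p := rfl

/-- The orders bound `i` above and `j = n + k - i` above; hence `i` is also bounded below and `k`
above, and each coefficient of a product is a finite sum. -/
theorem mulTerm_support {P Q : SPDO S} {N M : ℤ} (hP : P ∈ order S N) (hQ : Q ∈ order S M)
    (n : ℤ) {p : ℤ × ℕ} (h : mulTerm P Q n p ≠ 0) :
    p ∈ Finset.Icc (n - M) N ×ˢ Finset.range (M + N - n + 1).toNat := by
  have h1 : p.1 ≤ N := by
    by_contra hc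
    exact h (by simp [mulTerm, hP p.1 (by omega)])
  have h2 : n + p.2 - p.1 ≤ M := by
    by_contra hc
    exact h (by simp [mulTerm, hQ _ (not_le.1 hc), twist_zero])
  simp only [Finset.mem_product, Finset.mem_Icc, Finset.mem_range]
  omega

theorem mulTerm_finite (P Q : SPDO S) (n : ℤ) : (Function.support (mulTerm P Q n)).Finite := by
  obtain ⟨N, hN⟩ := P.exists_mem_order
  obtain ⟨M, hM⟩ := Q.exists_mem_order
  exact (Finset.finite_toSet _).subset fun p hp => mulTerm_support hN hM n hp

theorem mul_mem_order {P Q : SPDO S} {N M : ℤ} (hP : P ∈ order S N) (hQ : Q ∈ order S M) :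
    P * Q ∈ order S (N + M) := mulCoeff_eq_zero P Q N M hP hQ

theorem add_mul' (P Q T : SPDO S) : (P + Q) * T = P * T + Q * T := by
  ext n
  simp only [coeff_mul, coeff_add]
  rw [← finsum_add_distrib (mulTerm_finite P T n) (mulTerm_finite Q T n)]
  exact finsum_congr fun p => by simp [mulTerm, add_mul]

theorem mul_add' (P Q T : SPDO S) : P * (Q + T) = P * Q + P * T := by
  ext n
  simp only [coeff_mul, coeff_add]
  rw [← finsum_add_distrib (mulTerm_finite P Q n) (mulTerm_finite P T n)]
  refine finsum_congr fun p => ?_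
  simp only [mulTerm, coeff_add, ← twistHom_apply, map_add, mul_add, smul_add]

/-- The coefficients of a product with a monomial on the left. -/
theorem coeff_monomial_mul (a : A) (i : ℤ) (T : SPDO S) (n : ℤ) :
    (monomial S a i * T).coeff n = ∑ᶠ k : ℕ, superBinom i k •
      (a * (S.Dθ ^ k) (twist 𝒢 (i - k) (T.coeff (n + k - i)))) := by
  rw [coeff_mul, finsum_curry _ (mulTerm_finite _ _ _), finsum_eq_single _ i]
  · simp [mulTerm, coeff_monomial]
  · intro j hj
    simp [mulTerm, coeff_monomial, hj]

theorem coeff_monomial_mul_eq_sum (a : A) (i : ℤ) {T : SPDO S} {M : ℤ} (hT : T ∈ order S M)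
    (n : ℤ) {K : ℕ} (hK : M + i - n < K) :
    (monomial S a i * T).coeff n = ∑ k ∈ Finset.range K, superBinom i k •
      (a * (S.Dθ ^ k) (twist 𝒢 (i - k) (T.coeff (n + k - i)))) := by
  rw [coeff_monomial_mul]
  refine finsum_eq_sum_of_support_subset _ fun k hk => ?_
  by_contra hc
  simp only [Finset.coe_range, Set.mem_Iio, not_lt] at hc
  exact hk (by simp [hT (n + k - i) (by omega), twist_zero])

theorem coeff_C_mul (a : A) (T : SPDO S) (n : ℤ) : (C S a * T).coeff n = a * T.coeff n := by
  rw [C, coeff_monomial_mul, finsum_eq_single _ 0]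
  · simp [superBinom_zero_right, twist_eq]
  · intro k hk
    obtain ⟨k, rfl⟩ := Nat.exists_eq_succ_of_ne_zero hk
    simp [superBinom_zero_succ]

theorem coeff_D_mul (T : SPDO S) (n : ℤ) :
    (dpow S 1 * T).coeff n = S.Dθ (T.coeff n) + gradeInv 𝒢 (T.coeff (n - 1)) := by
  rw [dpow, coeff_monomial_mul, finsum_eq_sum_of_support_subset (s := Finset.range 2)]
  · rw [Finset.sum_range_succ, Finset.sum_range_one]
    have h := superBinom_self 1
    simp only [Nat.cast_one] at h
    simp [superBinom_zero_right, twist_eq, h, add_comm]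
  · intro k hk
    by_contra hc
    simp only [Finset.coe_range, Set.mem_Iio, not_lt] at hc
    obtain ⟨k, rfl⟩ := Nat.exists_eq_add_of_le' hc
    exact hk (by simp [superBinom_one])

theorem coeff_mul_dpow (P : SPDO S) (m n : ℤ) : (P * dpow S m).coeff n = P.coeff (n - m) := by
  rw [coeff_mul, finsum_eq_single _ (n - m, 0)]
  · simp [mulTerm, superBinom_zero_right, coeff_dpow, twist_map_one]
  · rintro ⟨i, k⟩ h
    simp only [mulTerm, coeff_dpow]
    by_cases hi : n + k - i = m
    · obtain _ | k := k
      · exact absurd (by simp at hi ⊢; omega) h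
      · have h0 : (S.Dθ ^ (k + 1)) (1 : A) = 0 := by
          rw [pow_succ, Module.End.mul_apply, S.Dθ_one, map_zero]
        rw [hi, if_pos rfl, twist_map_one, h0, mul_zero, smul_zero]
    · simp [hi, twist_zero]

theorem monomial_eq (a : A) (i : ℤ) : monomial S a i = C S a * dpow S i := by
  ext n
  rw [coeff_C_mul, coeff_monomial, coeff_dpow]; simp

theorem one_mul' (P : SPDO S) : 1 * P = P := by
  ext n
  rw [show (1 : SPDO S) = C S 1 from rfl, coeff_C_mul, one_mul]

theorem mul_one' (P : SPDO S) : P * 1 = P := by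
  ext n
  rw [show (1 : SPDO S) = dpow S 0 from rfl, coeff_mul_dpow, sub_zero]

theorem C_mul_assoc (a : A) (Q T : SPDO S) : C S a * Q * T = C S a * (Q * T) := by
  ext n
  rw [coeff_C_mul, coeff_mul, coeff_mul, mul_finsum' _ _ (mulTerm_finite _ _ _)]
  refine finsum_congr fun p => ?_
  simp only [mulTerm, coeff_C_mul, mul_assoc, mul_smul_comm]

theorem D_mul_C_mul (b : A) (U : SPDO S) :
    dpow S 1 * (C S b * U) = C S (S.Dθ b) * U + C S (gradeInv 𝒢 b) * (dpow S 1 * U) := by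
  ext n
  simp only [coeff_D_mul, coeff_C_mul, coeff_add, S.Dθ_mul, map_mul, mul_add, add_assoc]

theorem D_mul_dpow (j : ℤ) : dpow S 1 * dpow S j = dpow S (j + 1) := by
  ext n
  rw [coeff_mul_dpow, coeff_dpow, coeff_dpow]
  simp [sub_eq_iff_eq_add, add_comm]

/-- The heart of associativity: comparing coefficients on both sides is Pascal's rule for
`superBinom`. The sign in that rule comes from moving the grading involution past `Dθ ^ k`. -/
theorem D_mul_dpow_mul (j : ℤ) (T : SPDO S) :
    dpow S 1 * (dpow S j * T) = dpow S (j + 1) * T := by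
  ext n
  obtain ⟨M, hM⟩ := T.exists_mem_order
  set K := (M + j - n + 2).toNat with hK
  rw [coeff_D_mul, dpow, dpow, coeff_monomial_mul_eq_sum 1 j hM n (K := K) (by omega),
    coeff_monomial_mul_eq_sum 1 j hM (n - 1) (K := K + 1) (by omega),
    coeff_monomial_mul_eq_sum 1 (j + 1) hM n (K := K + 1) (by omega),
    Finset.sum_range_succ', Finset.sum_range_succ', map_add, map_sum, map_sum, ← add_assoc,
    ← Finset.sum_add_distrib]
  congr 1
  · refine Finset.sum_congr rfl fun k _ => ?_
    have e1 : n - 1 + ((k + 1 : ℕ) : ℤ) - j = n + k - j := by push_cast; ring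
    have e2 : n + ((k + 1 : ℕ) : ℤ) - (j + 1) = n + k - j := by push_cast; ring
    have e3 : j + 1 - ((k + 1 : ℕ) : ℤ) = j - k := by push_cast; ring
    have e4 : j - k = 1 + (j - ((k + 1 : ℕ) : ℤ)) := by push_cast; ring
    rw [e1, e2, e3, map_zsmul, map_zsmul, one_mul, one_mul, one_mul, S.gradeInv_Dθ_pow,
      ← twist_one_eq, ← twist_add, ← e4, superBinom_succ_succ, add_smul, pow_succ' S.Dθ,
      smul_smul, mul_comm ((-1 : ℤ) ^ (k + 1))]
    rfl
  · have e : n - 1 - j = n - (j + 1) := by ring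
    simp only [superBinom_zero_right, Nat.cast_zero, pow_zero, Module.End.one_apply, one_mul,
      one_smul, add_zero, sub_zero, e]
    rw [← twist_one_eq, ← twist_add, add_comm 1 j]

/-- If `𝒟 T = 0`, the coefficient just above the top order of `T` is the grading involution of the
leading coefficient. The latter vanishes, and the order can be lowered indefinitely. -/
theorem D_mul_injective {P Q : SPDO S} (h : dpow S 1 * P = dpow S 1 * Q) : P = Q := by
  have h0 : ∀ T : SPDO S, dpow S 1 * T = 0 → T = 0 := by
    intro T hT
    obtain ⟨N, hN⟩ := T.exists_mem_order
    have key : ∀ k : ℕ, T ∈ order S (N - k) := by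
      intro k
      induction k with
      | zero => simpa using hN
      | succ k ih =>
        intro n hn
        rcases eq_or_ne n (N - k) with rfl | hne
        · have h1 := congrArg (fun X => gradeInv 𝒢 (X.coeff (N - k + 1))) hT
          simp only [coeff_D_mul, ih (N - k + 1) (by omega), map_zero, zero_add, coeff_zero,
            add_sub_cancel_right, gradeInv_gradeInv] at h1
          exact h1
        · exact ih n (by push_cast at hn; omega)
    exact eq_zero_of_mem_order fun m => order_mono (by omega) (key (N - m).toNat)
  have hneg : dpow S 1 * (-Q) = -(dpow S 1 * Q) := by
    rw [eq_neg_iff_add_eq_zero, ← mul_add', neg_add_cancel]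
    ext n
    simp [coeff_D_mul]
  refine sub_eq_zero.1 (h0 _ ?_)
  rw [sub_eq_add_neg, mul_add', hneg, h, add_neg_cancel]

/-- Left multiplication as an additive map. -/
def mulLeftHom (P : SPDO S) : SPDO S →+ SPDO S := AddMonoidHom.mk' (P * ·) (mul_add' P)

/-- Right multiplication as an additive map. -/
def mulRightHom (T : SPDO S) : SPDO S →+ SPDO S :=
  AddMonoidHom.mk' (· * T) fun P Q => add_mul' P Q T

/-- For fixed `T` both sides are additive in `Q` of bounded order, so `Q = b 𝒟^j` suffices; there
the Leibniz rule for `b` and the action on powers of `𝒟` decide. -/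
theorem D_mul_assoc (Q T : SPDO S) : dpow S 1 * Q * T = dpow S 1 * (Q * T) := by
  have h : (mulRightHom T).comp (mulLeftHom (dpow S 1)) =
      (mulLeftHom (dpow S 1)).comp (mulRightHom T) := by
    obtain ⟨M, hM⟩ := T.exists_mem_order
    refine addHom_ext ⟨1 + M, fun N P hP => ?_⟩ ⟨1 + M, fun N P hP => ?_⟩ fun b j => ?_
    · exact order_mono (by omega) (mul_mem_order (mul_mem_order (dpow_mem_order 1) hP) hM)
    · exact order_mono (by omega) (mul_mem_order (dpow_mem_order 1) (mul_mem_order hP hM))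
    · change dpow S 1 * monomial S b j * T = dpow S 1 * (monomial S b j * T)
      rw [monomial_eq, D_mul_C_mul, add_mul', C_mul_assoc, C_mul_assoc, C_mul_assoc,
        D_mul_C_mul, D_mul_dpow, D_mul_dpow_mul]
  exact DFunLike.congr_fun h Q

theorem dpow_mul_assoc (i : ℤ) (Q T : SPDO S) : dpow S i * Q * T = dpow S i * (Q * T) := by
  induction i using Int.induction_on with
  | zero => rw [show dpow S 0 = 1 from rfl, one_mul', one_mul']
  | succ i ih => rw [← D_mul_dpow_mul, D_mul_assoc, ih, D_mul_dpow_mul]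
  -- Negative powers: multiply by `𝒟` on the left, which may be cancelled.
  | pred i ih =>
    refine D_mul_injective ?_
    rw [← D_mul_assoc, D_mul_dpow_mul, D_mul_dpow_mul, sub_add_cancel, ih]

theorem mul_assoc' (P Q T : SPDO S) : P * Q * T = P * (Q * T) := by
  have h : (mulRightHom T).comp (mulRightHom Q) = mulRightHom (Q * T) := by
    obtain ⟨M, hM⟩ := T.exists_mem_order
    obtain ⟨N, hN⟩ := Q.exists_mem_order
    refine addHom_ext ⟨N + M, fun K P hP => ?_⟩ ⟨N + M, fun K P hP => ?_⟩ fun b j => ?_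
    · exact order_mono (by omega) (mul_mem_order (mul_mem_order hP hN) hM)
    · exact mul_mem_order hP (mul_mem_order hN hM)
    · change monomial S b j * Q * T = monomial S b j * (Q * T)
      rw [monomial_eq, C_mul_assoc, C_mul_assoc, C_mul_assoc, dpow_mul_assoc]
  exact DFunLike.congr_fun h P

/-- The ring of super-pseudo-differential operators. -/
@[reducible] def instRing : Ring (SPDO S) where
  __ := (inferInstance : AddCommGroup (SPDO S))
  left_distrib := mul_add'
  right_distrib := add_mul'
  zero_mul P := (mulRightHom P).map_zero
  mul_zero P := (mulLeftHom P).map_zero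
  mul_assoc := mul_assoc'
  one_mul := one_mul'
  mul_one := mul_one'
  npow n P := P ^ n
  npow_zero _ := rfl
  npow_succ _ _ := rfl

end SPDO

attribute [local instance] SPDO.instRing

/-! ### Parity and superderivations in terms of the involution. -/

section Parity

variable {𝕜 A : Type*} [Field 𝕜] [Ring A] [Algebra 𝕜 A] (𝒢 : ZMod 2 → Submodule 𝕜 A)
  [GradedAlgebra 𝒢]

theorem gradeInv_pow_of_eq {a : A} {i : ℕ} (h : gradeInv 𝒢 a = (-1 : ℤ) ^ i • a) (s : ℕ) :
    (gradeInv 𝒢 ^ s) a = (-1 : ℤ) ^ (s * i) • a := by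
  induction s with
  | zero => simp
  | succ s ih =>
    rw [pow_succ', RingHom.mul_def, RingHom.comp_apply, ih, map_zsmul, h, smul_smul]
    ring_nf

/-- The component of the wrong parity equals its own negative, and `2` is invertible in `𝕜`. -/
theorem mem_of_gradeInv [CharZero 𝕜] {a : A} {i : ℕ} (h : gradeInv 𝒢 a = (-1 : ℤ) ^ i • a) :
    a ∈ 𝒢 i := by
  classical
  have two : ∀ x : A, x + x = 0 → x = 0 := fun x hx => by
    have h2 : (2 : 𝕜) • x = 0 := by rw [two_smul, hx]
    exact (smul_eq_zero.1 h2).resolve_left two_ne_zero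
  have hsum : (DirectSum.decompose 𝒢 a 0 : A) + (DirectSum.decompose 𝒢 a 1 : A) = a := by
    have := DirectSum.sum_support_decompose 𝒢 a
    rw [Finset.sum_subset (Finset.subset_univ _)] at this
    · exact (Fin.sum_univ_two _).symm.trans this
    · intro j _ hj
      simpa using hj
  have hdiff : (DirectSum.decompose 𝒢 a 0 : A) - (DirectSum.decompose 𝒢 a 1 : A) =
    (-1 : ℤ) ^ i • a := h
  have h0 := (DirectSum.decompose 𝒢 a 0).2
  have h1 := (DirectSum.decompose 𝒢 a 1).2
  generalize (DirectSum.decompose 𝒢 a 0 : A) = x at *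
  generalize (DirectSum.decompose 𝒢 a 1 : A) = y at *
  subst hsum
  rcases Nat.even_or_odd i with hi | hi
  · rw [hi.neg_one_pow, one_smul, ← sub_eq_zero] at hdiff
    have hy : y = 0 := two y (by rw [← neg_eq_zero, ← hdiff]; abel)
    rwa [ZMod.natCast_eq_zero_iff_even.2 hi, hy, add_zero]
  · rw [hi.neg_one_pow, neg_one_smul, ← sub_eq_zero] at hdiff
    have hx : x = 0 := two x (by rw [← hdiff]; abel)
    rwa [ZMod.natCast_eq_one_iff_odd.2 hi, hx, zero_add]

end Parity

/-- Superderivations of parity `s` that supercommute with `Dθ`, in terms of the grading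
involution. -/
structure IsFlow {𝕜 A : Type*} [Field 𝕜] [Ring A] [Algebra 𝕜 A] {𝒢 : ZMod 2 → Submodule 𝕜 A}
    [GradedAlgebra 𝒢] (S : Superspace 𝒢) (s : ℕ) (d : Module.End 𝕜 A) : Prop where
  mul : ∀ a b, d (a * b) = d a * b + (gradeInv 𝒢 ^ s) a * d b
  grade : ∀ a, d (gradeInv 𝒢 a) = (-1 : ℤ) ^ s • gradeInv 𝒢 (d a)
  Dθ : ∀ a, d (S.Dθ a) = (-1 : ℤ) ^ s • S.Dθ (d a)

theorem koszul_natCast (i j : ℕ) : koszul (i : ZMod 2) (j : ZMod 2) = (-1) ^ (i * j) := by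
  unfold koszul
  rcases Nat.even_or_odd i with hi | hi <;> rcases Nat.even_or_odd j with hj | hj <;>
  simp [ZMod.natCast_eq_zero_iff_even.2, ZMod.natCast_eq_one_iff_odd.2, hi, hj, pow_mul,
    hi.neg_one_pow, hj.neg_one_pow, ZMod.val_one]

namespace IsFlow

variable {𝕜 A : Type*} [Field 𝕜] [Ring A] [Algebra 𝕜 A] {𝒢 : ZMod 2 → Submodule 𝕜 A}
  [GradedAlgebra 𝒢] {S : Superspace 𝒢} {s t : ℕ} {d d' : Module.End 𝕜 A}

theorem of_isSuperDerivation (h : IsSuperDerivation 𝒢 (s : ZMod 2) d)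
    (hc : d * S.Dθ = (-1 : ℤ) ^ s • (S.Dθ * d)) : IsFlow S s d where
  mul a b := by
    induction a using homogeneous_induction 𝒢 with
    | zero => simp
    | add x y h₁ h₂ => rw [add_mul, map_add, h₁, h₂, map_add, map_add, add_mul, add_mul]; abel
    | hom i x hx =>
      rw [h.leibniz _ _ _ hx, gradeInv_pow_of_eq 𝒢 (gradeInv_of_mem 𝒢 hx), koszul_natCast,
        smul_mul_assoc]
  grade a := by
    induction a using homogeneous_induction 𝒢 with
    | zero => simp
    | add x y h₁ h₂ => rw [map_add, map_add, h₁, h₂, map_add, map_add, smul_add]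
    | hom i x hx =>
      have hd : d x ∈ 𝒢 ((i + s : ℕ) : ZMod 2) := by
        rw [Nat.cast_add]; exact h.map_mem _ _ hx
      rw [gradeInv_of_mem 𝒢 hx, gradeInv_of_mem 𝒢 hd, map_zsmul, smul_smul, pow_add,
        mul_left_comm, ← mul_pow]
      simp
  Dθ a := LinearMap.congr_fun hc a

theorem map_one (h : IsFlow S s d) : d 1 = 0 := by
  have := h.mul 1 1
  simpa using this

theorem grade_pow (h : IsFlow S s d) (t : ℕ) (a : A) :
    d ((gradeInv 𝒢 ^ t) a) = (-1 : ℤ) ^ (s * t) • (gradeInv 𝒢 ^ t) (d a) := by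
  induction t generalizing a with
  | zero => simp
  | succ t ih =>
    rw [pow_succ, RingHom.mul_def, RingHom.comp_apply, RingHom.comp_apply, ih, h.grade,
      map_zsmul, smul_smul, mul_add, mul_one, pow_add]

theorem Dθ_pow (h : IsFlow S s d) (k : ℕ) (a : A) :
    d ((S.Dθ ^ k) a) = ((-1 : ℤ) ^ k) ^ s • (S.Dθ ^ k) (d a) := by
  induction k generalizing a with
  | zero => simp
  | succ k ih =>
    rw [pow_succ, Module.End.mul_apply, ih, h.Dθ, map_zsmul, smul_smul, Module.End.mul_apply,
      pow_succ (-1 : ℤ), mul_pow]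

theorem twist (h : IsFlow S s d) (n : ℤ) (a : A) :
    d (twist 𝒢 n a) = (n.negOnePow : ℤ) ^ s • _root_.twist 𝒢 n (d a) := by
  rw [twist_eq, twist_eq]
  split_ifs with hn
  · simp [Int.negOnePow_even n hn]
  · simp [Int.negOnePow_odd n (Int.not_even_iff_odd.1 hn), h.grade]

/-- The supercommutator of flows. -/
theorem bracket (h : IsFlow S s d) (h' : IsFlow S t d') :
    IsFlow S (s + t) (d * d' - (-1 : ℤ) ^ (s * t) • (d' * d)) where
  mul a b := by
    -- The cross terms, where each flow hits one factor, occur in both orders of composition and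
    -- cancel because this sign squares to one.
    have e : ((-1 : ℤ) ^ (s * t)) * (-1 : ℤ) ^ (s * t) = 1 := by rw [← mul_pow]; simp
    simp only [LinearMap.sub_apply, LinearMap.smul_apply, Module.End.mul_apply, h.mul, h'.mul,
      map_add, h.grade_pow, h'.grade_pow]
    rw [mul_comm t s, pow_add, RingHom.mul_def, RingHom.comp_apply, ← RingHom.comp_apply,
      ← RingHom.comp_apply (gradeInv 𝒢 ^ t), ← RingHom.mul_def, ← RingHom.mul_def, ← pow_add,
      ← pow_add, add_comm t s]
    simp only [smul_add, smul_mul_assoc, smul_smul, e, one_smul, sub_mul, mul_sub, mul_smul_comm]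
    abel
  grade a := by
    simp only [LinearMap.sub_apply, LinearMap.smul_apply, Module.End.mul_apply, h.grade, h'.grade,
      map_zsmul, map_sub, smul_sub, smul_smul, pow_add]
    ring_nf
  Dθ a := by
    simp only [LinearMap.sub_apply, LinearMap.smul_apply, Module.End.mul_apply, h.Dθ, h'.Dθ,
      map_zsmul, map_sub, smul_sub, smul_smul, pow_add]
    ring_nf

theorem add (h : IsFlow S s d) (h' : IsFlow S s d') : IsFlow S s (d + d') where
  mul a b := by simp only [LinearMap.add_apply, h.mul, h'.mul, add_mul, mul_add]; abel
  grade a := by simp only [LinearMap.add_apply, h.grade, h'.grade, map_add, smul_add]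
  Dθ a := by simp only [LinearMap.add_apply, h.Dθ, h'.Dθ, map_add, smul_add]

theorem zsmul (h : IsFlow S s d) (z : ℤ) : IsFlow S s (z • d) where
  mul a b := by
    simp only [LinearMap.smul_apply, h.mul, smul_add, smul_mul_assoc, mul_smul_comm]
  grade a := by simp only [LinearMap.smul_apply, h.grade, map_zsmul, smul_comm z]
  Dθ a := by simp only [LinearMap.smul_apply, h.Dθ, map_zsmul, smul_comm z]

end IsFlow

/-! ### Flows acting coefficientwise on operators. -/

namespace SPDO

variable {𝕜 A : Type*} [Field 𝕜] [Ring A] [Algebra 𝕜 A] {𝒢 : ZMod 2 → Submodule 𝕜 A}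
  [GradedAlgebra 𝒢] {S : Superspace 𝒢}

/-- The parity involution as a map. -/
def parityInvFun (P : SPDO S) : SPDO S :=
  ⟨fun n => (n.negOnePow : ℤ) • gradeInv 𝒢 (P.coeff n), by
    obtain ⟨N, hN⟩ := P.2
    exact ⟨N, fun n hn => by simp [coeff, hN n hn]⟩⟩

theorem coeff_parityInvFun (P : SPDO S) (n : ℤ) :
    (parityInvFun P).coeff n = (n.negOnePow : ℤ) • gradeInv 𝒢 (P.coeff n) := rfl

/-- The parity involution `P ↦ (-1)^|P| P` of super-pseudo-differential operators. -/
def parityInv (S : Superspace 𝒢) : SPDO S →+* SPDO S where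
  toFun := parityInvFun
  map_zero' := ext fun n => by simp [coeff_parityInvFun]
  map_one' := ext fun n => by
    rw [coeff_parityInvFun, coeff_one]
    split_ifs with h
    · simp [h]
    · simp
  map_add' P Q := ext fun n => by simp [coeff_parityInvFun]
  map_mul' P Q := ext fun n => by
    rw [coeff_parityInvFun]
    rw [coeff_mul, coeff_mul, show gradeInv 𝒢 (∑ᶠ p, mulTerm P Q n p) =
        ∑ᶠ p, gradeInv 𝒢 (mulTerm P Q n p) from
          AddMonoidHom.map_finsum (gradeInv 𝒢).toAddMonoidHom (mulTerm_finite P Q n),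
      smul_finsum' (f := fun p => gradeInv 𝒢 (mulTerm P Q n p)) _ ((mulTerm_finite P Q n).subset
        (Function.support_comp_subset (map_zero (gradeInv 𝒢)) _))]
    refine finsum_congr fun p => ?_
    simp only [mulTerm, coeff_parityInvFun]
    rw [map_zsmul, map_mul, S.gradeInv_Dθ_pow, ← twistHom_apply 𝒢 _ (_ • _), map_zsmul,
      twistHom_apply, ← twist_one_eq 𝒢 (twist _ _ _), ← twist_one_eq 𝒢 (Q.coeff _), ← twist_add,
      ← twist_add, add_comm 1, map_zsmul, smul_mul_smul_comm, mul_smul_comm, smul_smul, smul_smul,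
      smul_smul]
    congr 1
    -- The order `n` of a term is `i + j - k`: the signs of the two monomials, corrected by the `k`
    -- derivatives `Dθ`, give the sign of the product.
    have e : n = p.1 + (n + p.2 - p.1) - p.2 := by ring
    have e2 : ((n.negOnePow : ℤˣ) : ℤ) =
        (p.1.negOnePow : ℤ) * ((n + p.2 - p.1).negOnePow : ℤ) * (-1) ^ p.2 := by
      nth_rewrite 1 [e]
      rw [Int.negOnePow_sub, Int.negOnePow_add]
      simp [Int.negOnePow_def]
    have e3 : ((-1 : ℤ) ^ p.2) * (-1) ^ p.2 = 1 := by rw [← mul_pow]; simp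
    rw [e2]
    linear_combination superBinom p.1 p.2 * ((p.1.negOnePow : ℤ) *
      ((n + p.2 - p.1).negOnePow : ℤ)) * e3

theorem coeff_parityInv (P : SPDO S) (n : ℤ) :
    (parityInv S P).coeff n = (n.negOnePow : ℤ) • gradeInv 𝒢 (P.coeff n) := rfl

theorem coeff_parityInv_pow (s : ℕ) (P : SPDO S) (n : ℤ) :
    ((parityInv S ^ s) P).coeff n = (n.negOnePow : ℤ) ^ s • (gradeInv 𝒢 ^ s) (P.coeff n) := by
  induction s with
  | zero => simp
  | succ s ih =>
    rw [pow_succ', RingHom.mul_def, RingHom.comp_apply, coeff_parityInv, ih, map_zsmul,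
      smul_smul, pow_succ', pow_succ', RingHom.mul_def, RingHom.comp_apply]

theorem parityInv_pow_of_eq {P : SPDO S} {i : ℕ} (h : parityInv S P = (-1 : ℤ) ^ i • P) (s : ℕ) :
    (parityInv S ^ s) P = (-1 : ℤ) ^ (s * i) • P := by
  induction s with
  | zero => simp
  | succ s ih =>
    rw [pow_succ', RingHom.mul_def, RingHom.comp_apply, ih, map_zsmul, h, smul_smul]
    ring_nf

/-- The Leibniz rule for flows acting coefficientwise on operators. -/
theorem map_op_mul {s : ℕ} {d : Module.End 𝕜 A} (h : IsFlow S s d) (P Q : SPDO S) :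
    (P * Q).map d = P.map d * Q + (parityInv S ^ s) P * Q.map d := by
  ext n
  rw [coeff_map, coeff_add, coeff_mul, coeff_mul, coeff_mul, ← LinearMap.toAddMonoidHom_coe,
    AddMonoidHom.map_finsum _ (mulTerm_finite P Q n),
    ← finsum_add_distrib (mulTerm_finite _ _ n) (mulTerm_finite _ _ n)]
  refine finsum_congr fun p => ?_
  simp only [mulTerm, LinearMap.toAddMonoidHom_coe, coeff_map, coeff_parityInv_pow]
  rw [map_zsmul, h.mul, h.Dθ_pow, h.twist, map_zsmul, smul_smul, ← smul_add, mul_smul_comm,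
    smul_mul_assoc, ← mul_pow]
  -- Moving `d` past `Dθ^k` and the twist by `i - k` costs `(-1)^k (-1)^(i-k) = (-1)^i` to the power
  -- `s`, which is the sign `parityInv ^ s` gives to `𝒟^i`.
  congr 4
  rw [Int.negOnePow_sub]
  have e3 : ((-1 : ℤ) ^ p.2) * (-1) ^ p.2 = 1 := by rw [← mul_pow]; simp
  simp only [Int.negOnePow_def, zpow_natCast, Units.val_mul, Units.val_pow_eq_pow_val, Units.val_neg,
    Units.val_one]
  linear_combination _ * e3

end SPDO

/-! ### Signs of the conjugation. -/

theorem sign_congr {m n : ℕ} (h : Even m ↔ Even n) : (-1 : ℤ) ^ m = (-1) ^ n := by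
  rcases Nat.even_or_odd m with hm | hm
  · rw [hm.neg_one_pow, (h.1 hm).neg_one_pow]
  · rw [hm.neg_one_pow, Odd.neg_one_pow]
    rwa [← Nat.not_even_iff_odd, ← h, Nat.not_even_iff_odd]

/-- Pascal's rule at upper index `-1`, where the left side has upper index `0` and vanishes. It
matches the recursion of the sign of conjugation, which lets conjugates be read off from expansions
of `𝒟⁻¹`. -/
theorem superBinom_neg_one_succ (k : ℕ) :
    superBinom (-1) (k + 1) = (-1) ^ k * superBinom (-1) k := by
  have h := superBinom_succ_succ (-1) k
  rw [neg_add_cancel, superBinom_zero_succ] at h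
  have e3 : ((-1 : ℤ) ^ k) * (-1) ^ k = 1 := by rw [← mul_pow]; simp
  rw [pow_succ] at h
  linear_combination (-1) ^ k * h - superBinom (-1) (k + 1) * e3

/-- The sign in the conjugate of `𝒟^k`. -/
theorem adjSign_eq (k : ℕ) :
    ((((k : ℤ) * (k + 1) / 2).negOnePow : ℤˣ) : ℤ) = (-1) ^ k * superBinom (-1) k := by
  induction k with
  | zero => simp [superBinom_zero_right]
  | succ k ih =>
    have e : ((k + 1 : ℕ) : ℤ) * ((k + 1 : ℕ) + 1) / 2 = (k : ℤ) * (k + 1) / 2 + ((k + 1 : ℕ) : ℤ) := by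
      have : ((k + 1 : ℕ) : ℤ) * ((k + 1 : ℕ) + 1) = (k : ℤ) * (k + 1) + ((k + 1 : ℕ) : ℤ) * 2 := by
        push_cast; ring
      rw [this, Int.add_mul_ediv_right _ _ two_ne_zero]
    rw [e, Int.negOnePow_add, Units.val_mul, ih, superBinom_neg_one_succ, Int.negOnePow_def,
      zpow_natCast, Units.val_pow_eq_pow_val, Units.val_neg, Units.val_one]
    ring

/-! ### Projections, residues and actions on superfields. -/

namespace SPDO

section Parts

variable {𝕜 A : Type*} [Field 𝕜] [Ring A] [Algebra 𝕜 A] {𝒢 : ZMod 2 → Submodule 𝕜 A}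
  {S : Superspace 𝒢}

theorem coeff_pos' (P : SPDO S) (n : ℤ) : P.pos.coeff n = if 0 ≤ n then P.coeff n else 0 := rfl

theorem coeff_neg' (P : SPDO S) (n : ℤ) : P.neg.coeff n = if n < 0 then P.coeff n else 0 := rfl

theorem pos_add_neg (P : SPDO S) : P.pos + P.neg = P := ext fun n => by
  rw [coeff_add, coeff_pos', coeff_neg']
  by_cases h : n < 0
  · simp [h, not_le.2 h]
  · simp [h, not_lt.1 h]

theorem pos_eq (P : SPDO S) : P.pos = P - P.neg := eq_sub_of_add_eq (pos_add_neg P)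

/-- Taking the purely pseudo-differential part is additive. -/
def negHom (S : Superspace 𝒢) : SPDO S →+ SPDO S :=
  AddMonoidHom.mk' neg fun P Q => ext fun n => by
    simp only [coeff_neg', coeff_add]; split_ifs <;> simp

theorem negPart_add (P Q : SPDO S) : (P + Q).neg = P.neg + Q.neg := (negHom S).map_add P Q
theorem negPart_sub (P Q : SPDO S) : (P - Q).neg = P.neg - Q.neg := (negHom S).map_sub P Q
theorem negPart_zsmul (z : ℤ) (P : SPDO S) : (z • P).neg = z • P.neg := (negHom S).map_zsmul z P
theorem negPart_sum {ι : Type*} (s : Finset ι) (f : ι → SPDO S) :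
    (∑ i ∈ s, f i).neg = ∑ i ∈ s, (f i).neg := map_sum (negHom S) f s

theorem neg_mem_order (P : SPDO S) : P.neg ∈ order S (-1) := fun n hn => by
  rw [coeff_neg', if_neg (by omega)]

theorem neg_of_mem_order {P : SPDO S} (h : P ∈ order S (-1)) : P.neg = P := ext fun n => by
  rw [coeff_neg']
  split_ifs with hn
  · rfl
  · rw [h n (by omega)]

theorem negPart_map (d : Module.End 𝕜 A) (P : SPDO S) : (P.map d).neg = P.neg.map d :=
  ext fun n => by
    simp only [coeff_neg', coeff_map]; split_ifs <;> simp

theorem C_add (a b : A) : C S (a + b) = C S a + C S b := ext fun n => by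
  simp only [coeff_add, coeff_C]; split_ifs <;> simp

/-- Multiplication operators depend additively on the superfield. -/
def CHom (S : Superspace 𝒢) : A →+ SPDO S := AddMonoidHom.mk' (C S) C_add

theorem C_zero : C S (0 : A) = 0 := (CHom S).map_zero
theorem C_neg (a : A) : C S (-a) = -C S a := (CHom S).map_neg a
theorem C_sub (a b : A) : C S (a - b) = C S a - C S b := (CHom S).map_sub a b
theorem C_zsmul (z : ℤ) (a : A) : C S (z • a) = z • C S a := (CHom S).map_zsmul z a
theorem C_sum {ι : Type*} (s : Finset ι) (f : ι → A) : C S (∑ i ∈ s, f i) = ∑ i ∈ s, C S (f i) :=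
  map_sum (CHom S) f s

theorem res_add (P Q : SPDO S) : (P + Q).res = P.res + Q.res := rfl
theorem res_sub (P Q : SPDO S) : (P - Q).res = P.res - Q.res := rfl
theorem res_zsmul (z : ℤ) (P : SPDO S) : (z • P).res = z • P.res := coeff_zsmul z P _
theorem res_sum {ι : Type*} (s : Finset ι) (f : ι → SPDO S) :
    (∑ i ∈ s, f i).res = ∑ i ∈ s, (f i).res := coeff_sum s f _

theorem res_eq_zero {P : SPDO S} {N : ℤ} (h : P ∈ order S N) (hN : N < -1) : P.res = 0 := h _ hN

theorem res_map (d : Module.End 𝕜 A) (P : SPDO S) : (P.map d).res = d P.res := rfl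

theorem map_C {d : Module.End 𝕜 A} (a : A) : (C S a).map d = C S (d a) := ext fun n => by
  rw [coeff_map, coeff_C, coeff_C]; split_ifs <;> simp

theorem map_op_neg (d : Module.End 𝕜 A) (P : SPDO S) : (-P).map d = -P.map d :=
  ext fun n => by simp

theorem map_op_sum {ι : Type*} (d : Module.End 𝕜 A) (s : Finset ι) (f : ι → SPDO S) :
    (∑ i ∈ s, f i).map d = ∑ i ∈ s, (f i).map d :=
  ext fun n => by simp

theorem applyPos_congr {P Q : SPDO S} (h : ∀ n, 0 ≤ n → P.coeff n = Q.coeff n) (f : A) :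
    P.applyPos f = Q.applyPos f := finsum_congr fun j => by rw [h j (by omega)]

theorem applyPos_pos (P : SPDO S) (f : A) : P.pos.applyPos f = P.applyPos f :=
  applyPos_congr (fun n hn => by rw [coeff_pos', if_pos hn]) f

theorem applyPos_dpow (j : ℕ) (f : A) : (dpow S j).applyPos f = (S.Dθ ^ j) f := by
  rw [applyPos, finsum_eq_single _ j]
  · simp [coeff_dpow]
  · intro k hk
    simp [coeff_dpow, hk]

end Parts

variable {𝕜 A : Type*} [Field 𝕜] [Ring A] [Algebra 𝕜 A] {𝒢 : ZMod 2 → Submodule 𝕜 A}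
  [GradedAlgebra 𝒢] {S : Superspace 𝒢}

/-- The subring of differential operators. -/
def diff (S : Superspace 𝒢) : Subring (SPDO S) where
  carrier := {P | ∀ n, n < 0 → P.coeff n = 0}
  zero_mem' := fun _ _ => rfl
  one_mem' := fun n hn => by rw [coeff_one, if_neg (ne_of_lt hn)]
  add_mem' hP hQ n hn := by simp [hP n hn, hQ n hn]
  neg_mem' hP n hn := by simp [hP n hn]
  mul_mem' {P Q} hP hQ n hn := by
    rw [coeff_mul, finsum_eq_zero_of_forall_eq_zero]
    rintro ⟨i, k⟩
    simp only [mulTerm]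
    -- For `i ≥ 0`, either `k > i` and the binomial vanishes, or `n + k - i < 0` and the coefficient
    -- of `Q` does.
    by_cases hi : i < 0
    · simp [hP i hi]
    · lift i to ℕ using not_lt.1 hi
      by_cases hk : i < k
      · simp [superBinom_of_lt hk]
      · simp [hQ (n + k - i) (by omega), twist_zero]

theorem pos_mem_diff (P : SPDO S) : P.pos ∈ diff S := fun n hn => by
  rw [coeff_pos', if_neg (by omega)]

theorem C_mem_diff (a : A) : C S a ∈ diff S := fun n hn => by
  rw [coeff_C, if_neg (by omega)]

theorem neg_of_mem_diff {P : SPDO S} (h : P ∈ diff S) : P.neg = 0 := ext fun n => by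
  rw [coeff_neg']
  split_ifs with hn
  · exact h n hn
  · rfl

theorem C_mul_C (a b : A) : C S a * C S b = C S (a * b) := ext fun n => by
  rw [coeff_C_mul, coeff_C, coeff_C]; split_ifs <;> simp

theorem D_mul_C (a : A) :
    dpow S 1 * C S a = C S (S.Dθ a) + C S (gradeInv 𝒢 a) * dpow S 1 := by
  have := D_mul_C_mul (S := S) a 1
  simpa using this

theorem dpow_mul_dpow (i j : ℤ) : dpow S i * dpow S j = dpow S (i + j) := ext fun n => by
  rw [coeff_mul_dpow, coeff_dpow, coeff_dpow]
  congr 1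
  exact propext sub_eq_iff_eq_add

theorem D_mul_Dinv : dpow S 1 * dpow S (-1) = 1 := by rw [dpow_mul_dpow]; rfl
theorem Dinv_mul_D : dpow S (-1) * dpow S 1 = 1 := by rw [dpow_mul_dpow]; rfl

/-- Integration by parts: `𝒟⁻¹ (Dθ r) 𝒟⁻¹ = r 𝒟⁻¹ - 𝒟⁻¹ (-1)^|r| r`. -/
theorem Dinv_mul_C_Dθ_mul_Dinv (r : A) : dpow S (-1) * C S (S.Dθ r) * dpow S (-1) =
    C S r * dpow S (-1) - dpow S (-1) * C S (gradeInv 𝒢 r) := by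
  have h := D_mul_C (S := S) r
  rw [← sub_eq_iff_eq_add] at h
  rw [← h, mul_sub, sub_mul, ← mul_assoc, ← mul_assoc, Dinv_mul_D, one_mul,
    mul_assoc _ (dpow S 1) _, D_mul_Dinv, mul_one]

theorem res_C_mul (a : A) (P : SPDO S) : (C S a * P).res = a * P.res := coeff_C_mul a P _

/-- Only terms with `k = i + 1` can contribute; for `i ≥ 0` their binomial vanishes, leaving `i =
-1`, `k = 0`. -/
theorem res_mul_C (P : SPDO S) (b : A) : (P * C S b).res = P.res * gradeInv 𝒢 b := by
  rw [res, coeff_mul, finsum_eq_single _ (-1, 0)]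
  · simp [mulTerm, superBinom_zero_right, coeff_C, twist_eq, res]
  · rintro ⟨i, k⟩ h
    simp only [mulTerm, coeff_C]
    split_ifs with hi
    · have : superBinom i k = 0 := by
        rcases lt_or_ge i 0 with h0 | h0
        · exact absurd (Prod.ext (show i = -1 by omega) (show k = 0 by omega)) h
        · lift i to ℕ using h0
          exact superBinom_of_lt (by omega)
      simp [this]
    · simp [twist_zero]

theorem coeff_zero_mul_C (P : SPDO S) (f : A) : (P * C S f).coeff 0 = P.applyPos f := by
  rw [coeff_mul, finsum_curry _ (mulTerm_finite _ _ _), applyPos]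
  classical
  have h : ∀ i : ℤ, ∑ᶠ k : ℕ, mulTerm P (C S f) 0 (i, k) =
      ∑ᶠ _ : i ∈ Set.range (Nat.cast : ℕ → ℤ), P.coeff i * (S.Dθ ^ i.toNat) f := by
    intro i
    by_cases hi : i ∈ Set.range (Nat.cast : ℕ → ℤ)
    · rw [finsum_eq_if, if_pos hi]
      obtain ⟨i, rfl⟩ := hi
      rw [finsum_eq_single _ i]
      · simp [mulTerm, superBinom_self, coeff_C, twist_eq]
      · intro k hk
        have : (0 : ℤ) + k - i ≠ 0 := by omega
        simp only [mulTerm, coeff_C, if_neg this, twist_zero, map_zero, mul_zero, smul_zero]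
    · rw [finsum_eq_if, if_neg hi]
      refine finsum_eq_zero_of_forall_eq_zero fun k => ?_
      have : (0 : ℤ) + k - i ≠ 0 := fun h => hi ⟨k, by omega⟩
      simp only [mulTerm, coeff_C, if_neg this, twist_zero, map_zero, mul_zero, smul_zero]
  rw [finsum_congr h, finsum_mem_range Nat.cast_injective]
  simp

/-- Turns the action on functions into a residue, so that identities between operators, integration
by parts above all, can be applied to it. -/
theorem applyPos_eq_res (P : SPDO S) (f : A) :
    P.applyPos f = (P * C S f * dpow S (-1)).res := by
  rw [res, coeff_mul_dpow, ← coeff_zero_mul_C]; rfl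

/-- For a differential operator `X`, `(X 𝒟⁻¹)_- = X_0 𝒟⁻¹`. -/
theorem neg_mul_Dinv {X : SPDO S} (hX : X ∈ diff S) :
    (X * dpow S (-1)).neg = C S (X.coeff 0) * dpow S (-1) := ext fun n => by
  rw [coeff_neg', coeff_mul_dpow, coeff_C_mul, coeff_dpow]
  split_ifs with h1 h2 h2
  · simp [h2]
  · rw [hX _ (by omega), mul_zero]
  · omega
  · simp

theorem neg_mul_C_neg (X : SPDO S) (b : A) : (X * C S b).neg = X.neg * C S b := by
  conv_lhs => rw [← pos_add_neg X, add_mul, negPart_add,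
    neg_of_mem_diff (mul_mem (pos_mem_diff X) (C_mem_diff b)), zero_add]
  exact neg_of_mem_order (order_mono (by decide) (mul_mem_order (neg_mem_order X) (C_mem_order b)))

theorem neg_C_mul_neg (X : SPDO S) (a : A) : (C S a * X).neg = C S a * X.neg := by
  conv_lhs => rw [← pos_add_neg X, mul_add, negPart_add,
    neg_of_mem_diff (mul_mem (C_mem_diff a) (pos_mem_diff X)), zero_add]
  exact neg_of_mem_order (order_mono (by decide) (mul_mem_order (C_mem_order a) (neg_mem_order X)))

/-- Only the order-zero coefficient of the differential operator `B a` reaches the negative part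
after multiplication by `𝒟⁻¹`, and that coefficient is `B(a)`. -/
theorem neg_diff_mul {B : SPDO S} (hB : B ∈ diff S) (a b : A) :
    (B * (C S a * dpow S (-1) * C S b)).neg = C S (B.applyPos a) * dpow S (-1) * C S b := by
  rw [← mul_assoc, ← mul_assoc, neg_mul_C_neg, neg_mul_Dinv (mul_mem hB (C_mem_diff a)),
    coeff_zero_mul_C]

theorem D_mem_diff : dpow S 1 ∈ diff S := fun n hn => by
  rw [coeff_dpow, if_neg (by omega)]

/-- For a differential operator `X`, `(𝒟⁻¹ X)_- = 𝒟⁻¹ f`. -/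
theorem neg_Dinv_mul {X : SPDO S} (hX : X ∈ diff S) :
    (dpow S (-1) * X).neg = dpow S (-1) * C S (gradeInv 𝒢 (dpow S (-1) * X).res) := by
  set Z := dpow S (-1) * X with hZ
  have h1 : dpow S 1 * Z.neg = X - dpow S 1 * Z.pos := by
    rw [pos_eq, mul_sub, hZ, ← mul_assoc, D_mul_Dinv, one_mul, sub_sub_cancel]
  have h2 : dpow S 1 * Z.neg ∈ diff S := by
    rw [h1]; exact sub_mem hX (mul_mem D_mem_diff (pos_mem_diff Z))
  -- `𝒟 Z_-` is a differential operator by `h2` and has order at most `0`, hence is multiplication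
  -- by a superfield.
  have h3 : dpow S 1 * Z.neg = C S (gradeInv 𝒢 Z.res) := ext fun n => by
    rw [coeff_C]
    split_ifs with hn
    · subst hn
      rw [coeff_D_mul, coeff_neg', coeff_neg']
      simp [res]
    · rcases lt_or_gt_of_ne hn with hn | hn
      · exact h2 n hn
      · exact mul_mem_order (dpow_mem_order 1) (neg_mem_order Z) n (by omega)
  rw [← h3, ← mul_assoc, Dinv_mul_D, one_mul]

theorem neg_mul_diff {B : SPDO S} (hB : B ∈ diff S) (a b : A) :
    (C S a * dpow S (-1) * C S b * B).neg =
      C S a * dpow S (-1) * C S (gradeInv 𝒢 (dpow S (-1) * C S b * B).res) := by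
  rw [mul_assoc, mul_assoc, neg_C_mul_neg, neg_Dinv_mul (mul_mem (C_mem_diff b) hB), mul_assoc,
    mul_assoc]

theorem coeff_adj (P : SPDO S) {n : ℤ} (hn : 0 ≤ n) {N : ℤ} (hP : P ∈ order S N) {K : ℕ}
    (hK : N < K) : (adj P).coeff n = (∑ j ∈ Finset.range K,
      ((((j : ℤ) * (j + 1) / 2).negOnePow : ℤˣ) : ℤ) • (dpow S j * C S (twist 𝒢 j (P.coeff j)))).coeff
        n := by
  change ∑ᶠ j : ℤ, (((j * (j + 1) / 2).negOnePow : ℤˣ) : ℤ) •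
    (dpow S j * C S (twist 𝒢 j (P.coeff j))).coeff n = _
  rw [finsum_eq_sum_of_support_subset (s := (Finset.range K).map Nat.castEmbedding)]
  · rw [Finset.sum_map, coeff_sum]
    exact Finset.sum_congr rfl fun j _ => (coeff_zsmul _ _ _).symm
  · intro j hj
    by_contra hc
    apply hj
    beta_reduce
    -- Negative `j` give operators of negative order, invisible in a coefficient with `n ≥ 0`; large
    -- `j` exceed the order of `P`.
    rcases lt_or_ge j 0 with h0 | h0
    · rw [mul_mem_order (dpow_mem_order j) (C_mem_order _) n (by omega), smul_zero]
    · lift j to ℕ using h0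
      have h1 : K ≤ j := by simpa using hc
      rw [hP j (by omega), twist_zero, C_zero, mul_zero, coeff_zero, smul_zero]

theorem applyPos_adj (P : SPDO S) (b : A) {N : ℤ} (hP : P ∈ order S N) {K : ℕ} (hK : N < K) :
    (adj P).applyPos b = ∑ j ∈ Finset.range K,
      ((-1) ^ j * superBinom (-1) j) • (S.Dθ ^ j) (twist 𝒢 j (P.coeff j) * b) := by
  rw [applyPos_congr (fun n hn => coeff_adj P hn hP hK), ← coeff_zero_mul_C, Finset.sum_mul,
    coeff_sum]
  refine Finset.sum_congr rfl fun j _ => ?_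
  rw [smul_mul_assoc, coeff_zsmul, mul_assoc, C_mul_C, coeff_zero_mul_C, applyPos_dpow, adjSign_eq]

theorem twist_natCast (𝒢 : ZMod 2 → Submodule 𝕜 A) [GradedAlgebra 𝒢] (k : ℕ) (a : A) :
    twist 𝒢 k a = (gradeInv 𝒢 ^ k) a := by
  induction k with
  | zero => simp [twist_eq]
  | succ k ih =>
    rw [Nat.cast_succ, add_comm, twist_add, twist_one_eq, ih, pow_succ']; rfl

/-- The action of a conjugate operator as a residue. -/
theorem applyPos_adj_eq_res {P : SPDO S} {m j : ℕ} (hP : ∀ n : ℕ, P.coeff n ∈ 𝒢 ((m + n : ℕ)))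
    {b : A} (hb : b ∈ 𝒢 j) : (adj P).applyPos b =
      (-1 : ℤ) ^ (j * m + j + m) • (dpow S (-1) * C S b * P).res := by
  obtain ⟨N, hN⟩ := P.exists_mem_order
  have h1 : C S b * P ∈ order S N := by simpa using mul_mem_order (C_mem_order b) hN
  rw [applyPos_adj P b hN (K := (N + 1).toNat) (by omega), mul_assoc, res, dpow,
    coeff_monomial_mul_eq_sum _ _ h1 _ (K := (N + 1).toNat) (by omega), Finset.smul_sum]
  refine Finset.sum_congr rfl fun k _ => ?_
  have e1 : (-1 : ℤ) + k - -1 = k := by ring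
  have e2 : twist 𝒢 (-1 - k) (b * P.coeff k) = twist 𝒢 ((k + 1 : ℕ)) (b * P.coeff k) := by
    rw [twist_eq, twist_eq]
    congr 1
    rw [eq_iff_iff]; push_cast
    grind
  have hPb := S.supercomm _ _ _ _ hb (hP k)
  rw [koszul_natCast] at hPb
  have hbP : P.coeff k * b ∈ 𝒢 ((m + k + j : ℕ) : ZMod 2) := by
    rw [Nat.cast_add (m + k)]; exact SetLike.GradedMul.mul_mem (hP k) hb
  rw [e1, coeff_C_mul, e2, twist_natCast, twist_natCast, hPb, map_zsmul,
    gradeInv_pow_of_eq 𝒢 (gradeInv_of_mem 𝒢 hbP), gradeInv_pow_of_eq 𝒢 (gradeInv_of_mem 𝒢 (hP k)),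
    smul_mul_assoc, one_mul, map_zsmul, map_zsmul, map_zsmul, smul_smul, smul_smul, smul_smul, smul_smul]
  congr 1
  -- On the left are the signs of conjugation; on the right those of moving `b` past the coefficient
  -- of `P` and both past `𝒟^(-1-k)`. They differ by a factor independent of `k`.
  have : (-1 : ℤ) ^ k * (-1) ^ (k * (m + k)) =
      (-1) ^ (j * m + j + m) * ((-1) ^ (j * (m + k)) * (-1) ^ ((k + 1) * (m + k + j))) := by
    simp only [← pow_add]
    exact sign_congr (by grind)
  linear_combination superBinom (-1) k * this

end SPDO

open SPDO

/-! ### Variation of dressed operators. -/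

namespace SPDO

variable {𝕜 A : Type*} [Field 𝕜] [Ring A] [Algebra 𝕜 A] {𝒢 : ZMod 2 → Submodule 𝕜 A}
  [GradedAlgebra 𝒢] {S : Superspace 𝒢}

theorem parityInv_C (a : A) : parityInv S (C S a) = C S (gradeInv 𝒢 a) := ext fun n => by
  rw [coeff_parityInv, coeff_C, coeff_C]
  split_ifs with h
  · simp [h]
  · simp

theorem parityInv_C_of_mem {a : A} {i : ℕ} (h : a ∈ 𝒢 i) :
    parityInv S (C S a) = (-1 : ℤ) ^ i • C S a := by
  rw [parityInv_C, gradeInv_of_mem 𝒢 h, C_zsmul]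

theorem parityInv_dpow (n : ℤ) : parityInv S (dpow S n) = (n.negOnePow : ℤ) • dpow S n :=
  ext fun m => by
    rw [coeff_parityInv, coeff_zsmul, coeff_dpow]
    split_ifs with h
    · simp [h]
    · simp

theorem parityInv_dpow_natCast (n : ℕ) : parityInv S (dpow S n) = (-1 : ℤ) ^ n • dpow S n := by
  rw [parityInv_dpow]
  simp [Int.negOnePow_def]

theorem parityInv_Dinv : parityInv S (dpow S (-1)) = (-1 : ℤ) ^ 1 • dpow S (-1) := by
  rw [parityInv_dpow]
  simp

theorem parityInv_mul_of_eq {P Q : SPDO S} {i j : ℕ} (hP : parityInv S P = (-1 : ℤ) ^ i • P)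
    (hQ : parityInv S Q = (-1 : ℤ) ^ j • Q) :
    parityInv S (P * Q) = (-1 : ℤ) ^ (i + j) • (P * Q) := by
  rw [_root_.map_mul, hP, hQ, smul_mul_smul_comm, pow_add]

/-- The residue of an operator of parity `i` has parity `i + 1`. -/
theorem gradeInv_res {P : SPDO S} {i : ℕ} (h : parityInv S P = (-1 : ℤ) ^ i • P) :
    gradeInv 𝒢 P.res = (-1 : ℤ) ^ (i + 1) • P.res := by
  have h1 := congrArg (fun X => X.coeff (-1)) h
  simp only [coeff_parityInv, coeff_zsmul] at h1
  rw [res, pow_succ, mul_comm, mul_smul, ← h1]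
  simp

theorem map_dpow {s : ℕ} {d : Module.End 𝕜 A} (h : IsFlow S s d) (n : ℤ) :
    (dpow S n).map d = 0 := ext fun m => by
  rw [coeff_map, coeff_dpow, coeff_zero]
  split_ifs
  · exact h.map_one
  · exact map_zero d

theorem map_one_op {s : ℕ} {d : Module.End 𝕜 A} (h : IsFlow S s d) : (1 : SPDO S).map d = 0 :=
  map_dpow h 0

theorem map_C_mul_Dinv_mul_C {s : ℕ} {d : Module.End 𝕜 A} (h : IsFlow S s d) {a : A} {i : ℕ}
    (ha : a ∈ 𝒢 i) (b : A) : (C S a * dpow S (-1) * C S b).map d =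
      C S (d a) * dpow S (-1) * C S b +
        (-1 : ℤ) ^ (s * (i + 1)) • (C S a * dpow S (-1) * C S (d b)) := by
  rw [map_op_mul h, map_op_mul h, map_dpow h, mul_zero, add_zero, map_C, map_C,
    parityInv_pow_of_eq (parityInv_mul_of_eq (parityInv_C_of_mem ha) parityInv_Dinv),
    smul_mul_assoc]

variable {s t : ℕ} {d d' : Module.End 𝕜 A}

/-- The variation of `W Q W⁻¹` for constant `Q`. -/
theorem map_conj {W V X Q : SPDO S} {m : ℕ} (hd : IsFlow S s d) (hWV : W * V = 1)
    (hVW : V * W = 1) (hV : parityInv S V = V) (hW : parityInv S W = W) (hX : W.map d = X * W)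
    (hQ : Q.map d = 0) (hQm : parityInv S Q = (-1 : ℤ) ^ m • Q) :
    (W * Q * V).map d = X * (W * Q * V) - (-1 : ℤ) ^ (s * m) • (W * Q * V * X) := by
  have hVs : (parityInv S ^ s) V = V := by
    simpa using parityInv_pow_of_eq (i := 0) (by simpa using hV) s
  have hWs : (parityInv S ^ s) W = W := by
    simpa using parityInv_pow_of_eq (i := 0) (by simpa using hW) s
  -- Differentiate `V W = 1` and multiply by `V` on the right; no sign arises since `V` is even.
  have hVd : V.map d = -(V * X) := by
    have h := map_op_mul hd V W
    rw [hVW, map_one_op hd, hVs, hX] at h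
    have h1 : V.map d * W * V = -(V * X) * W * V := by
      rw [eq_neg_of_add_eq_zero_left h.symm]; noncomm_ring
    rwa [mul_assoc, mul_assoc, hWV, mul_one, mul_one] at h1
  rw [map_op_mul hd, map_op_mul hd, hQ, mul_zero, add_zero, hVd, hX, _root_.map_mul, hWs,
    parityInv_pow_of_eq hQm s]
  simp only [mul_smul_comm, smul_mul_assoc, mul_neg, mul_assoc, sub_eq_add_neg]

/-- The bracket of two flows on a dressing operator. -/
theorem map_bracket {W X Y : SPDO S} (hd : IsFlow S s d) (hd' : IsFlow S t d')
    (hX : W.map d = X * W) (hY : W.map d' = Y * W) (hXs : parityInv S X = (-1 : ℤ) ^ s • X)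
    (hYt : parityInv S Y = (-1 : ℤ) ^ t • Y) :
    W.map (d * d' - (-1 : ℤ) ^ (s * t) • (d' * d)) =
      (Y.map d - (-1 : ℤ) ^ (s * t) • X.map d' - (X * Y - (-1 : ℤ) ^ (s * t) • (Y * X))) * W := by
  have h1 : W.map (d * d' - (-1 : ℤ) ^ (s * t) • (d' * d)) =
      (W.map d').map d - (-1 : ℤ) ^ (s * t) • (W.map d).map d' := ext fun n => by
    rw [coeff_sub, coeff_zsmul]; rfl
  have e : (-1 : ℤ) ^ (s * t) * (-1 : ℤ) ^ (s * t) = 1 := by rw [← mul_pow]; simp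
  rw [h1, hX, hY, map_op_mul hd, map_op_mul hd', hX, hY, parityInv_pow_of_eq hYt,
    parityInv_pow_of_eq hXs, mul_comm t s]
  simp only [smul_mul_assoc, smul_add, smul_smul, e, one_smul, sub_mul, mul_assoc]
  abel

end SPDO

/-! ### The Manin-Radul flows as one sequence. -/

variable {𝕜 A : Type*} [Field 𝕜] [Ring A] [Algebra 𝕜 A] {𝒢 : ZMod 2 → Submodule 𝕜 A}

/-- The Manin-Radul flows in a single sequence: `∂/∂t_l` for `m = 2 l`, `D_n` for `m = 2 n - 1`. -/
def mrFlow (S : Superspace 𝒢) (m : ℕ) : Module.End 𝕜 A :=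
  if Even m then S.dt (m / 2) else S.dD ((m + 1) / 2)

theorem mrFlow_even (S : Superspace 𝒢) (l : ℕ) : mrFlow S (2 * l) = S.dt l := by
  simp [mrFlow]

theorem mrFlow_odd (S : Superspace 𝒢) {n : ℕ} (hn : 1 ≤ n) : mrFlow S (2 * n - 1) = S.dD n := by
  have h : ¬ Even (2 * n - 1) := by grind
  rw [mrFlow, if_neg h]
  congr 1
  omega

variable [GradedAlgebra 𝒢] {S : Superspace 𝒢}

theorem one_le_cases {p : ℕ → Prop} (he : ∀ l, 1 ≤ l → p (2 * l))
    (ho : ∀ n, 1 ≤ n → p (2 * n - 1)) (m : ℕ) (hm : 1 ≤ m) : p m := by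
  obtain ⟨l, rfl | rfl⟩ := Nat.even_or_odd' m
  · exact he l (by omega)
  · exact ho (l + 1) (by omega)

theorem natCast_two_mul_sub_one {n : ℕ} (hn : 1 ≤ n) : ((2 * n - 1 : ℕ) : ZMod 2) = 1 :=
  ZMod.natCast_eq_one_iff_odd.2 (by grind)

theorem natCast_two_mul (n : ℕ) : ((2 * n : ℕ) : ZMod 2) = 0 :=
  ZMod.natCast_eq_zero_iff_even.2 (by simp)

theorem odd_two_mul_sub_one {n : ℕ} (hn : 1 ≤ n) : Odd (2 * n - 1) := by grind

theorem mrFlow_isFlow (S : Superspace 𝒢) (m : ℕ) (hm : 1 ≤ m) : IsFlow S m (mrFlow S m) := by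
  refine one_le_cases (p := fun m => IsFlow S m (mrFlow S m)) (fun l hl => ?_) (fun n hn => ?_) m hm
  · refine IsFlow.of_isSuperDerivation ?_ ?_
    · rw [mrFlow_even, natCast_two_mul]
      exact S.dt_der l hl
    · rw [mrFlow_even, (even_two_mul l).neg_one_pow, one_smul]
      exact S.dt_Dθ l hl
  · refine IsFlow.of_isSuperDerivation ?_ ?_
    · rw [mrFlow_odd S hn, natCast_two_mul_sub_one hn]
      exact S.dD_der n hn
    · rw [mrFlow_odd S hn, (odd_two_mul_sub_one hn).neg_one_pow, neg_one_smul]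
      exact S.dD_Dθ n hn

namespace IsMRSKP

variable {W V : SPDO S}

theorem parityInv_W (h : IsMRSKP W V) : parityInv S W = W := SPDO.ext fun n => by
  rw [coeff_parityInv]
  have hb := h.bosonic n
  rcases Int.even_or_odd n with hn | hn
  · have h0 : W.coeff n ∈ 𝒢 ((0 : ℕ) : ZMod 2) := by
      rwa [(ZMod.intCast_eq_zero_iff_even).2 hn, ← Nat.cast_zero] at hb
    rw [gradeInv_of_mem 𝒢 h0, Int.negOnePow_even n hn]; simp
  · have h0 : W.coeff n ∈ 𝒢 ((1 : ℕ) : ZMod 2) := by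
      rwa [(ZMod.intCast_eq_one_iff_odd).2 hn, ← Nat.cast_one] at hb
    rw [gradeInv_of_mem 𝒢 h0, Int.negOnePow_odd n hn]; simp

theorem parityInv_V (h : IsMRSKP W V) : parityInv S V = V := by
  have h1 : W * parityInv S V = 1 := by
    conv_lhs => rw [← h.parityInv_W, ← map_mul, h.mul_inv, map_one]
  calc parityInv S V = V * W * parityInv S V := by rw [h.inv_mul, one_mul]
    _ = V := by rw [mul_assoc, h1, mul_one]

theorem laxOp_pow (h : IsMRSKP W V) (m : ℕ) : laxOp W V ^ m = W * dpow S m * V := by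
  induction m with
  | zero => rw [pow_zero, Nat.cast_zero, show dpow S 0 = 1 from rfl, mul_one, h.mul_inv]
  | succ m ih =>
    rw [pow_succ, ih, laxOp, Nat.cast_succ, ← dpow_mul_dpow]
    calc W * dpow S m * V * (W * dpow S 1 * V) = W * dpow S m * (V * W) * dpow S 1 * V := by
          noncomm_ring
      _ = _ := by rw [h.inv_mul]; noncomm_ring

theorem parityInv_laxOp_pow (h : IsMRSKP W V) (m : ℕ) :
    parityInv S (laxOp W V ^ m) = (-1 : ℤ) ^ m • laxOp W V ^ m := by
  rw [h.laxOp_pow, map_mul, map_mul, h.parityInv_W, h.parityInv_V, parityInv_dpow_natCast,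
    mul_smul_comm, smul_mul_assoc]

theorem mrFlow_W (h : IsMRSKP W V) (m : ℕ) (hm : 1 ≤ m) :
    W.map (mrFlow S m) = -(laxOp W V ^ m).neg * W := by
  refine one_le_cases (p := fun m => W.map (mrFlow S m) = -(laxOp W V ^ m).neg * W)
    (fun l hl => ?_) (fun n hn => ?_) m hm
  · rw [mrFlow_even, h.dt_eq l hl, h.laxOp_pow, neg_mul]
    push_cast; rfl
  · have e : ((2 * n - 1 : ℕ) : ℤ) = 2 * n - 1 := by omega
    rw [mrFlow_odd S hn, h.dD_eq n hn, h.laxOp_pow, neg_mul, e]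

theorem map_laxOp_pow {s : ℕ} {d : Module.End 𝕜 A} (h : IsMRSKP W V) (hd : IsFlow S s d)
    {X : SPDO S} (hX : W.map d = X * W) (m : ℕ) : (laxOp W V ^ m).map d =
      X * laxOp W V ^ m - (-1 : ℤ) ^ (s * m) • (laxOp W V ^ m * X) := by
  rw [h.laxOp_pow]
  exact map_conj hd h.mul_inv h.inv_mul h.parityInv_V h.parityInv_W hX (map_dpow hd m)
    (parityInv_dpow_natCast m)

/-- The case `X = 0` of the variation of `L`: a flow that kills the dressing operator kills the Lax
operator. -/
theorem map_laxOp_eq_zero {s : ℕ} {d : Module.End 𝕜 A} (h : IsMRSKP W V) (hd : IsFlow S s d)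
    (hX : W.map d = 0) : (laxOp W V).map d = 0 := by
  have := h.map_laxOp_pow hd (X := 0) (by rw [hX, zero_mul]) 1
  simpa using this

theorem coeff_laxOp_pow_mem [CharZero 𝕜] (h : IsMRSKP W V) (m n : ℕ) :
    (laxOp W V ^ m).coeff n ∈ 𝒢 ((m + n : ℕ) : ZMod 2) := by
  refine mem_of_gradeInv 𝒢 ?_
  have h1 := congrArg (fun X => X.coeff n) (h.parityInv_laxOp_pow m)
  simp only [coeff_parityInv, coeff_zsmul] at h1
  have e : ((n : ℤ).negOnePow : ℤ) = (-1) ^ n := by simp [Int.negOnePow_def]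
  have e2 : (-1 : ℤ) ^ n * (-1) ^ n = 1 := by rw [← mul_pow]; simp
  rw [add_comm, pow_add, mul_smul, ← h1, smul_smul, e, e2, one_smul]

end IsMRSKP

theorem IsSEF.mrFlow {L : SPDO S} {p : ZMod 2} {φ : A} (h : IsSEF L p φ) (m : ℕ) (hm : 1 ≤ m) :
    mrFlow S m φ = (L ^ m).applyPos φ := by
  refine one_le_cases (p := fun m => _root_.mrFlow S m φ = (L ^ m).applyPos φ)
    (fun l hl => ?_) (fun n hn => ?_) m hm
  · rw [mrFlow_even, h.dt_eq l hl]
  · rw [mrFlow_odd S hn, h.dD_eq n hn]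

theorem IsAdjSEF.mrFlow {L : SPDO S} {p : ZMod 2} {ψ : A} (h : IsAdjSEF L p ψ) (m : ℕ)
    (hm : 1 ≤ m) : mrFlow S m ψ = -(adj (L ^ m)).applyPos ψ := by
  refine one_le_cases (p := fun m => _root_.mrFlow S m ψ = -(adj (L ^ m)).applyPos ψ)
    (fun l hl => ?_) (fun n hn => ?_) m hm
  · rw [mrFlow_even, h.dt_eq l hl]
  · rw [mrFlow_odd S hn, h.dD_eq n hn]

/-- The residue form avoids conjugates altogether. Characteristic zero enters through the parity of
the coefficients of `L ^ m`. -/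
theorem IsAdjSEF.mrFlow_eq_res [CharZero 𝕜] {W V : SPDO S} (hW : IsMRSKP W V) {j : ℕ} {ψ : A}
    (h : IsAdjSEF (laxOp W V) (j : ZMod 2) ψ) (m : ℕ) (hm : 1 ≤ m) : _root_.mrFlow S m ψ =
      -((-1 : ℤ) ^ (j * m + j + m) • (dpow S (-1) * C S ψ * laxOp W V ^ m).res) := by
  rw [h.mrFlow m hm, applyPos_adj_eq_res (hW.coeff_laxOp_pow_mem m) h.parity]

theorem SEPEvolves.mrFlow {L : SPDO S} {Φ Ψ : ℕ → A} {R : ℕ → ℕ → A} (h : SEPEvolves L Φ Ψ R)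
    (k j m : ℕ) (hm : 1 ≤ m) : mrFlow S m (R k j) = (-1 : ℤ) ^ (m * (k + 1)) •
      (dpow S (-1) * C S (Ψ k) * L ^ m * C S (Φ j) * dpow S (-1)).res := by
  refine one_le_cases (p := fun m => _root_.mrFlow S m (R k j) = (-1 : ℤ) ^ (m * (k + 1)) •
    (dpow S (-1) * C S (Ψ k) * L ^ m * C S (Φ j) * dpow S (-1)).res)
    (fun l hl => ?_) (fun n hn => ?_) m hm
  · rw [mrFlow_even, h.dt_eq k j l hl, mul_assoc 2, (even_two_mul _).neg_one_pow, one_smul]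
  · rw [mrFlow_odd S hn, h.dD_eq k j n hn, pow_mul, (odd_two_mul_sub_one hn).neg_one_pow]

theorem IsGhostFlow.isFlow {W : SPDO S} {Φ Ψ : ℕ → A} {R : ℕ → ℕ → A} {g : ℕ → Module.End 𝕜 A}
    (h : IsGhostFlow W Φ Ψ R g) (s : ℕ) (hs : 1 ≤ s) : IsFlow S s (g s) :=
  IsFlow.of_isSuperDerivation (h.der s hs) (h.comm_Dθ s hs)

open SPDO

section

variable {𝕜 A : Type*} [Field 𝕜] [Ring A] [Algebra 𝕜 A] {𝒢 : ZMod 2 → Submodule 𝕜 A}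
  {S : Superspace 𝒢}

theorem sep_mul_comm {Φ Ψ : ℕ → A} {R : ℕ → ℕ → A} (hR : IsSEP S Φ Ψ R)
    (k j : ℕ) {i : ℕ} {a : A} (ha : a ∈ 𝒢 i) :
    a * R k j = (-1 : ℤ) ^ (i * (k + j + 1)) • (R k j * a) := by
  have hm : R k j ∈ 𝒢 ((k + j + 1 : ℕ) : ZMod 2) := by push_cast; exact hR.parity k j
  rw [S.supercomm _ _ _ _ ha hm, koszul_natCast]

/-- The action of the conjugate ghost operators, with potentials on the left. -/
theorem ghostAdjApply_eq {Φ Ψ : ℕ → A} {R : ℕ → ℕ → A} (hR : IsSEP S Φ Ψ R)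
    (hΨ : ∀ j : ℕ, Ψ j ∈ 𝒢 j) (s l : ℕ) :
    ghostAdjApply Ψ R s l = ∑ k ∈ Finset.range s,
      (-1 : ℤ) ^ ((s - 1 - k) + l * (s + 1)) • (R l (s - 1 - k) * Ψ k) := by
  refine Finset.sum_congr rfl fun k hk => ?_
  have hk := Finset.mem_range.1 hk
  obtain ⟨j, rfl⟩ : ∃ j, s = j + k + 1 := ⟨s - 1 - k, by omega⟩
  have e : j + k + 1 - 1 - k = j := by omega
  rw [e, mul_smul_comm, sep_mul_comm hR _ _ (hΨ k), smul_smul, smul_smul, ← pow_add, ← pow_add]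
  congr 1
  exact sign_congr (by grind)

end

variable {𝕜 A : Type*} [Field 𝕜] [Ring A] [Algebra 𝕜 A] {𝒢 : ZMod 2 → Submodule 𝕜 A}
  [GradedAlgebra 𝒢] {S : Superspace 𝒢}

theorem neg_one_pow_mul_self (n : ℕ) : (-1 : ℤ) ^ n * (-1) ^ n = 1 := by rw [← mul_pow]; simp

theorem parityInv_C_mul_Dinv_mul_C {a b : A} {i k : ℕ} (ha : a ∈ 𝒢 i) (hb : b ∈ 𝒢 k) :
    parityInv S (C S a * dpow S (-1) * C S b) =
      (-1 : ℤ) ^ (i + 1 + k) • (C S a * dpow S (-1) * C S b) :=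
  parityInv_mul_of_eq (parityInv_mul_of_eq (parityInv_C_of_mem ha) parityInv_Dinv)
    (parityInv_C_of_mem hb)

/-! ### Ghost operators and their zero-curvature equations. -/

section Ghost

variable {Φ Ψ : ℕ → A}

theorem parityInv_ghostOp (hΦ : ∀ j : ℕ, Φ j ∈ 𝒢 j) (hΨ : ∀ j : ℕ, Ψ j ∈ 𝒢 j) (s : ℕ) :
    parityInv S (ghostOp S Φ Ψ s) = (-1 : ℤ) ^ s • ghostOp S Φ Ψ s := by
  rw [ghostOp, map_sum, Finset.smul_sum]
  refine Finset.sum_congr rfl fun k hk => ?_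
  have hk := Finset.mem_range.1 hk
  rw [parityInv_C_mul_Dinv_mul_C (hΦ _) (hΨ _), show s - 1 - k + 1 + k = s by omega]

theorem C_mul_Dinv_mul_C_mem_order (a b : A) :
    C S a * dpow S (-1) * C S b ∈ order S (-1) := by
  have := mul_mem_order (mul_mem_order (C_mem_order (S := S) a) (dpow_mem_order (-1)))
    (C_mem_order b)
  simpa using this

theorem ghostOp_mem_order (s : ℕ) : ghostOp S Φ Ψ s ∈ order S (-1) :=
  sum_mem fun _ _ => C_mul_Dinv_mul_C_mem_order _ _

/-- The evolution of the ghost operators along the Manin-Radul flows. -/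
theorem map_mrFlow_ghostOp [CharZero 𝕜] {W V : SPDO S} (hW : IsMRSKP W V)
    (hΦ : ∀ j : ℕ, IsSEF (laxOp W V) j (Φ j)) (hΨ : ∀ j : ℕ, IsAdjSEF (laxOp W V) j (Ψ j))
    (m s : ℕ) (hm : 1 ≤ m) : (ghostOp S Φ Ψ s).map (mrFlow S m) =
      ((laxOp W V ^ m).pos * ghostOp S Φ Ψ s
        - (-1 : ℤ) ^ (m * s) • (ghostOp S Φ Ψ s * (laxOp W V ^ m).pos)).neg := by
  rw [ghostOp, map_op_sum, Finset.mul_sum, Finset.sum_mul, Finset.smul_sum,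
    ← Finset.sum_sub_distrib, negPart_sum]
  refine Finset.sum_congr rfl fun k hk => ?_
  have hk := Finset.mem_range.1 hk
  obtain ⟨j, rfl⟩ : ∃ j, s = j + k + 1 := ⟨s - 1 - k, by omega⟩
  have e : j + k + 1 - 1 - k = j := by omega
  set L := laxOp W V with hL
  -- The negative part of `L ^ m` would contribute an operator of order at most `-2`, which has no
  -- residue.
  have hres : (dpow S (-1) * C S (Ψ k) * (L ^ m).pos).res =
      (dpow S (-1) * C S (Ψ k) * L ^ m).res := by
    rw [pos_eq, mul_sub, res_sub, sub_eq_self]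
    exact res_eq_zero (mul_mem_order (mul_mem_order (dpow_mem_order _) (C_mem_order _))
      (neg_mem_order _)) (by decide)
  have hpar : parityInv S (dpow S (-1) * C S (Ψ k) * L ^ m) =
      (-1 : ℤ) ^ (1 + k + m) • (dpow S (-1) * C S (Ψ k) * L ^ m) :=
    parityInv_mul_of_eq (parityInv_mul_of_eq parityInv_Dinv (parityInv_C_of_mem (hΨ k).parity))
      (hW.parityInv_laxOp_pow m)
  rw [e, map_C_mul_Dinv_mul_C (mrFlow_isFlow S m hm) (hΦ j).parity, negPart_sub, negPart_zsmul,
    neg_diff_mul (pos_mem_diff _), neg_mul_diff (pos_mem_diff _), (hΦ j).mrFlow m hm,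
    applyPos_pos, (hΨ k).mrFlow_eq_res hW m hm, hres, gradeInv_res hpar, C_neg, C_zsmul, C_zsmul,
    mul_neg, mul_smul_comm, mul_smul_comm, smul_neg, smul_smul, smul_smul, ← sub_eq_add_neg,
    ← pow_add, ← pow_add]
  congr 2
  exact sign_congr (by grind)

variable {R : ℕ → ℕ → A}

/-- The middle factor `Ψ_b Φ_c` is `Dθ (R b c)`, so integration by parts splits the product into two
operators with a single `𝒟⁻¹` each. -/
theorem ghostTerm_mul (hR : IsSEP S Φ Ψ R) (a d : A) (b c : ℕ) :
    C S a * dpow S (-1) * C S (Ψ b) * (C S (Φ c) * dpow S (-1) * C S d) =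
      C S (a * R b c) * dpow S (-1) * C S d -
        C S a * dpow S (-1) * C S (gradeInv 𝒢 (R b c) * d) := by
  have h := Dinv_mul_C_Dθ_mul_Dinv (S := S) (R b c)
  rw [hR.Dθ_eq] at h
  calc _ = C S a * (dpow S (-1) * (C S (Ψ b) * C S (Φ c)) * dpow S (-1)) * C S d := by
        noncomm_ring
    _ = _ := by rw [C_mul_C, h, ← C_mul_C, ← C_mul_C]; noncomm_ring

theorem gradeInv_sep (hR : IsSEP S Φ Ψ R) (k j : ℕ) :
    gradeInv 𝒢 (R k j) = (-1 : ℤ) ^ (k + j + 1) • R k j :=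
  gradeInv_of_mem 𝒢 (by push_cast; exact hR.parity k j)

/-- The product of two ghost operators. -/
theorem ghostOp_mul_ghostOp (hR : IsSEP S Φ Ψ R) (hΨ : ∀ j : ℕ, Ψ j ∈ 𝒢 j) (s t : ℕ) :
    ghostOp S Φ Ψ s * ghostOp S Φ Ψ t =
      ∑ k ∈ Finset.range t, C S (ghostApply Φ R s (t - 1 - k)) * dpow S (-1) * C S (Ψ k) +
      ∑ k ∈ Finset.range s, (-1 : ℤ) ^ (t * k) •
        (C S (Φ (s - 1 - k)) * dpow S (-1) * C S (ghostAdjApply Ψ R t k)) := by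
  have h1 : ∀ k, C S (ghostApply Φ R s (t - 1 - k)) * dpow S (-1) * C S (Ψ k) =
      ∑ b ∈ Finset.range s,
        C S (Φ (s - 1 - b) * R b (t - 1 - k)) * dpow S (-1) * C S (Ψ k) := fun k => by
    rw [ghostApply, C_sum, Finset.sum_mul, Finset.sum_mul]
  simp only [h1]
  rw [ghostOp, ghostOp, Finset.sum_mul, Finset.sum_comm, ← Finset.sum_add_distrib]
  refine Finset.sum_congr rfl fun b _ => ?_
  rw [ghostAdjApply_eq hR hΨ, C_sum, Finset.mul_sum, Finset.mul_sum, Finset.smul_sum,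
    ← Finset.sum_add_distrib]
  refine Finset.sum_congr rfl fun d hd => ?_
  have hd := Finset.mem_range.1 hd
  obtain ⟨c, rfl⟩ : ∃ c, t = c + d + 1 := ⟨t - 1 - d, by omega⟩
  have e : c + d + 1 - 1 - d = c := by omega
  rw [e, ghostTerm_mul hR, gradeInv_sep hR, C_zsmul, mul_smul_comm, smul_mul_assoc, C_zsmul,
    mul_smul_comm, smul_smul, ← pow_add, sub_eq_add_neg, ← neg_smul]
  congr 2
  rw [← neg_one_mul, ← pow_succ']
  exact sign_congr (by grind)

/-- The shift of the left index supplies the terms `k < t` and the shift of the right index those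
with `t ≤ k < s + t`. This is how the inhomogeneous terms of two ghost flows assemble into the
operator of index `s + t`. -/
theorem sum_range_splice {M : Type*} [AddCommMonoid M] (f : ℕ → ℕ → M) (s t : ℕ) :
    ∑ k ∈ Finset.range t, f (s + (t - 1 - k)) k + ∑ k ∈ Finset.range s, f (s - 1 - k) (t + k) =
      ∑ k ∈ Finset.range (s + t), f (s + t - 1 - k) k := by
  rw [add_comm s t, Finset.sum_range_add]
  congr 1
  · refine Finset.sum_congr rfl fun k hk => ?_
    have hk := Finset.mem_range.1 hk
    congr 1; omega
  · refine Finset.sum_congr rfl fun k hk => ?_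
    have hk := Finset.mem_range.1 hk
    congr 1; omega

/-- A ghost flow of a ghost operator. -/
theorem map_ghostFlow_ghostOp {W : SPDO S} {g : ℕ → Module.End 𝕜 A}
    (hg : IsGhostFlow W Φ Ψ R g) (hΦ : ∀ j : ℕ, Φ j ∈ 𝒢 j) (s t : ℕ) (hs : 1 ≤ s) :
    (ghostOp S Φ Ψ t).map (g s) =
      ∑ k ∈ Finset.range t, C S (ghostApply Φ R s (t - 1 - k)) * dpow S (-1) * C S (Ψ k)
      - ∑ k ∈ Finset.range t, C S (Φ (s + (t - 1 - k))) * dpow S (-1) * C S (Ψ k)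
      - (-1 : ℤ) ^ (s * t) • ∑ k ∈ Finset.range t, (-1 : ℤ) ^ (s * k) •
        (C S (Φ (t - 1 - k)) * dpow S (-1) * C S (ghostAdjApply Ψ R s k))
      + (-1 : ℤ) ^ (s * t) • ∑ k ∈ Finset.range t,
        C S (Φ (t - 1 - k)) * dpow S (-1) * C S (Ψ (s + k)) := by
  rw [ghostOp, map_op_sum, Finset.smul_sum, Finset.smul_sum, ← Finset.sum_sub_distrib,
    ← Finset.sum_sub_distrib, ← Finset.sum_add_distrib]
  refine Finset.sum_congr rfl fun k hk => ?_
  have hk := Finset.mem_range.1 hk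
  obtain ⟨j, rfl⟩ : ∃ j, t = j + k + 1 := ⟨t - 1 - k, by omega⟩
  have e : j + k + 1 - 1 - k = j := by omega
  have e1 : (-1 : ℤ) ^ (s * (j + 1)) = (-1) ^ (s * (j + k + 1) + s * k) := sign_congr (by grind)
  have e2 : (-1 : ℤ) ^ (s * (j + 1) + s * k) = (-1) ^ (s * (j + k + 1)) := sign_congr (by grind)
  rw [e, map_C_mul_Dinv_mul_C (hg.isFlow s hs) (hΦ j), hg.eigen s j hs, hg.adjEigen s k hs, C_sub,
    C_add, C_neg, C_zsmul, mul_add (C S _ * _), mul_neg, mul_smul_comm, smul_add, smul_neg, smul_smul,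
    ← pow_add, e2, e1, pow_add, mul_smul]
  noncomm_ring

/-- The ghost flows of the ghost operators. -/
theorem ghostFlow_zero_curvature {W : SPDO S} {g : ℕ → Module.End 𝕜 A}
    (hR : IsSEP S Φ Ψ R) (hg : IsGhostFlow W Φ Ψ R g) (hΦ : ∀ j : ℕ, Φ j ∈ 𝒢 j)
    (hΨ : ∀ j : ℕ, Ψ j ∈ 𝒢 j) (s t : ℕ) (hs : 1 ≤ s) (ht : 1 ≤ t) :
    (ghostOp S Φ Ψ t).map (g s) - (-1 : ℤ) ^ (s * t) • (ghostOp S Φ Ψ s).map (g t)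
      - (ghostOp S Φ Ψ s * ghostOp S Φ Ψ t
        - (-1 : ℤ) ^ (s * t) • (ghostOp S Φ Ψ t * ghostOp S Φ Ψ s)) =
      ((-1 : ℤ) ^ (s * t) - 1) • ghostOp S Φ Ψ (s + t) := by
  have h1 := sum_range_splice (fun i k => C S (Φ i) * dpow S (-1) * C S (Ψ k)) s t
  have h2 := sum_range_splice (fun i k => C S (Φ i) * dpow S (-1) * C S (Ψ k)) t s
  have e := neg_one_pow_mul_self (s * t)
  rw [map_ghostFlow_ghostOp hg hΦ s t hs, map_ghostFlow_ghostOp hg hΦ t s ht,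
    ghostOp_mul_ghostOp hR hΨ s t, ghostOp_mul_ghostOp hR hΨ t s, mul_comm t s, sub_smul, one_smul]
  rw [add_comm t s] at h2
  change _ = ghostOp S Φ Ψ (s + t) at h1 h2
  -- The two copies of `M_(s+t)` are cut differently, at `t` and at `s`: each combines one shift
  -- term from the flow `g s` with one from `g t`.
  conv_rhs => enter [2]; rw [← h1]
  rw [← h2]
  simp only [smul_add, smul_sub, smul_smul, e, one_smul]
  abel

variable {W V : SPDO S} {g : ℕ → Module.End 𝕜 A}

/-- The ghost flows supercommute with the Manin-Radul flows on the dressing operator. -/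
theorem map_bracket_ghostFlow_mrFlow [CharZero 𝕜] (hW : IsMRSKP W V)
    (hΦ : ∀ j : ℕ, IsSEF (laxOp W V) j (Φ j)) (hΨ : ∀ j : ℕ, IsAdjSEF (laxOp W V) j (Ψ j))
    (hg : IsGhostFlow W Φ Ψ R g) (s m : ℕ) (hs : 1 ≤ s) (hm : 1 ≤ m) :
    W.map (g s * mrFlow S m - (-1 : ℤ) ^ (s * m) • (mrFlow S m * g s)) = 0 := by
  have hM := parityInv_ghostOp (S := S) (fun j => (hΦ j).parity) (fun j => (hΨ j).parity) s
  have hgs := hg.isFlow s hs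
  have hY : parityInv S (-(laxOp W V ^ m).neg) = (-1 : ℤ) ^ m • -(laxOp W V ^ m).neg := by
    rw [_root_.map_neg, smul_neg, ← negPart_zsmul, ← hW.parityInv_laxOp_pow m]
    congr 1
    ext n
    simp only [coeff_parityInv, coeff_neg']
    split_ifs <;> simp
  rw [map_bracket hgs (mrFlow_isFlow S m hm) (hg.dressing s hs) (hW.mrFlow_W m hm) hM hY,
    map_mrFlow_ghostOp hW hΦ hΨ m s hm, map_op_neg, ← negPart_map,
    hW.map_laxOp_pow hgs (hg.dressing s hs) m]
  set M := ghostOp S Φ Ψ s with hMdef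
  have hMo : M ∈ order S (-1) := ghostOp_mem_order s
  -- Products of two operators of negative order are their own negative part, so writing `L^m_+ =
  -- L^m - L^m_-` makes all terms cancel.
  have h1 : (M * (laxOp W V ^ m).neg).neg = M * (laxOp W V ^ m).neg :=
    neg_of_mem_order (order_mono (by decide) (mul_mem_order hMo (neg_mem_order _)))
  have h2 : ((laxOp W V ^ m).neg * M).neg = (laxOp W V ^ m).neg * M :=
    neg_of_mem_order (order_mono (by decide) (mul_mem_order (neg_mem_order _) hMo))
  have e := neg_one_pow_mul_self (s * m)
  rw [mul_comm m s, pos_eq]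
  refine (congrArg (· * W) ?_).trans (zero_mul W)
  simp only [negPart_sub, negPart_zsmul, mul_sub, sub_mul, h1, h2, smul_sub, smul_smul, e, one_smul,
    mul_neg, neg_mul, smul_neg]
  abel

/-- The algebra of the ghost flows on the dressing operator. -/
theorem map_bracket_ghostFlow_ghostFlow (hR : IsSEP S Φ Ψ R)
    (hg : IsGhostFlow W Φ Ψ R g) (hΦ : ∀ j : ℕ, Φ j ∈ 𝒢 j)
    (hΨ : ∀ j : ℕ, Ψ j ∈ 𝒢 j) (s t : ℕ) (hs : 1 ≤ s) (ht : 1 ≤ t) :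
    W.map (g s * g t - (-1 : ℤ) ^ (s * t) • (g t * g s)
      + (1 - (-1 : ℤ) ^ (s * t)) • g (s + t)) = 0 := by
  have h : W.map (g s * g t - (-1 : ℤ) ^ (s * t) • (g t * g s)
      + (1 - (-1 : ℤ) ^ (s * t)) • g (s + t)) =
      W.map (g s * g t - (-1 : ℤ) ^ (s * t) • (g t * g s))
      + (1 - (-1 : ℤ) ^ (s * t)) • W.map (g (s + t)) := ext fun n => by
    rw [coeff_add, coeff_zsmul]; rfl
  rw [h, map_bracket (hg.isFlow s hs) (hg.isFlow t ht) (hg.dressing s hs) (hg.dressing t ht)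
    (parityInv_ghostOp hΦ hΨ s) (parityInv_ghostOp hΦ hΨ t),
    ghostFlow_zero_curvature hR hg hΦ hΨ s t hs ht, hg.dressing (s + t) (by omega),
    smul_mul_assoc, ← add_smul, sub_add_sub_cancel, sub_self, zero_smul]

end Ghost

open SPDO

/-! ### Ghost flows on eigenfunctions and adjoint eigenfunctions. -/

section Eigenfunctions

variable {𝕜 A : Type*} [Field 𝕜] [Ring A] [Algebra 𝕜 A] {𝒢 : ZMod 2 → Submodule 𝕜 A}
  [GradedAlgebra 𝒢] {S : Superspace 𝒢}

theorem sign_smul_congr {m n : ℕ} (h : Even m ↔ Even n) (a : A) :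
    (-1 : ℤ) ^ m • a = (-1 : ℤ) ^ n • a := by rw [sign_congr h]

namespace SPDO

theorem applyPos_add_right (P : SPDO S) (f h : A) :
    P.applyPos (f + h) = P.applyPos f + P.applyPos h := by
  simp only [← coeff_zero_mul_C, C_add, mul_add, coeff_add]

/-- The action of a differential operator as an additive map. -/
def applyPosHom (P : SPDO S) : A →+ A := AddMonoidHom.mk' P.applyPos P.applyPos_add_right

theorem applyPos_sub_left (P Q : SPDO S) (f : A) :
    (P - Q).applyPos f = P.applyPos f - Q.applyPos f := by
  simp only [← coeff_zero_mul_C, sub_mul, coeff_sub]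

theorem applyPos_zsmul_left (z : ℤ) (P : SPDO S) (f : A) :
    (z • P).applyPos f = z • P.applyPos f := by
  simp only [← coeff_zero_mul_C, smul_mul_assoc, coeff_zsmul]

/-- The Leibniz rule for the action of operators on superfields. -/
theorem flow_applyPos {s m : ℕ} {d : Module.End 𝕜 A} (hd : IsFlow S s d) {P : SPDO S}
    (hP : parityInv S P = (-1 : ℤ) ^ m • P) (f : A) :
    d (P.applyPos f) = (P.map d).applyPos f + (-1 : ℤ) ^ (s * m) • P.applyPos (d f) := by
  rw [← coeff_zero_mul_C, ← coeff_map, map_op_mul hd, coeff_add, coeff_zero_mul_C, map_C,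
    parityInv_pow_of_eq hP, smul_mul_assoc, coeff_zsmul, coeff_zero_mul_C]

/-- The action of the conjugate of `Q` on a superfield, up to sign. -/
def coAction (Q : SPDO S) : A →+ A :=
  AddMonoidHom.mk' (fun f => (dpow S (-1) * C S f * Q).res) fun f h => by
    rw [C_add, mul_add, add_mul, res_add]

theorem coAction_apply (Q : SPDO S) (f : A) :
    coAction Q f = (dpow S (-1) * C S f * Q).res := rfl

end SPDO

variable {Φ Ψ : ℕ → A} {R : ℕ → ℕ → A} {W V : SPDO S} {g : ℕ → Module.End 𝕜 A}

theorem Dinv_mul_mul_Dinv (hR : IsSEP S Φ Ψ R) (b c : ℕ) :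
    dpow S (-1) * C S (Ψ b) * C S (Φ c) * dpow S (-1) =
      C S (R b c) * dpow S (-1) - dpow S (-1) * C S (gradeInv 𝒢 (R b c)) := by
  rw [mul_assoc (dpow S (-1)), C_mul_C, ← hR.Dθ_eq, Dinv_mul_C_Dθ_mul_Dinv]

theorem applyPos_ghostOp_mul (Q : SPDO S) (s j : ℕ) :
    (ghostOp S Φ Ψ s * Q).applyPos (Φ j) = ∑ k ∈ Finset.range s, Φ (s - 1 - k) *
      (dpow S (-1) * C S (Ψ k) * Q * C S (Φ j) * dpow S (-1)).res := by
  rw [applyPos_eq_res, ghostOp, Finset.sum_mul, Finset.sum_mul, Finset.sum_mul, res_sum]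
  refine Finset.sum_congr rfl fun k _ => ?_
  rw [← res_C_mul]
  congr 1
  noncomm_ring

/-- Integration by parts shows that acting with the composite differs from acting with `Q` on
`M_s(Φ_j)`. The subtracted terms are those produced when a Manin-Radul flow hits the left factor of
`Φ R`. -/
theorem applyPos_mul_ghostOp (hR : IsSEP S Φ Ψ R) (Q : SPDO S) (s j : ℕ) :
    (Q * ghostOp S Φ Ψ s).applyPos (Φ j) = ∑ k ∈ Finset.range s,
      (Q.applyPos (Φ (s - 1 - k) * R k j) - Q.applyPos (Φ (s - 1 - k)) * R k j) := by
  rw [applyPos_eq_res, ghostOp, Finset.mul_sum, Finset.sum_mul, Finset.sum_mul, res_sum]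
  refine Finset.sum_congr rfl fun k _ => ?_
  have h : Q * (C S (Φ (s - 1 - k)) * dpow S (-1) * C S (Ψ k)) * C S (Φ j) * dpow S (-1) =
      Q * C S (Φ (s - 1 - k) * R k j) * dpow S (-1) -
        Q * C S (Φ (s - 1 - k)) * dpow S (-1) * C S (gradeInv 𝒢 (R k j)) := by
    calc _ = Q * C S (Φ (s - 1 - k)) *
          (dpow S (-1) * C S (Ψ k) * C S (Φ j) * dpow S (-1)) := by noncomm_ring
      _ = _ := by rw [Dinv_mul_mul_Dinv hR, ← C_mul_C]; noncomm_ring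
  rw [h, res_sub, res_mul_C, gradeInv_gradeInv, ← applyPos_eq_res, ← applyPos_eq_res]

/-- The ghost flows supercommute with the Manin-Radul flows on the eigenfunctions. -/
theorem bracket_ghostFlow_mrFlow_eigen (hW : IsMRSKP W V)
    (hΦ : ∀ j : ℕ, IsSEF (laxOp W V) j (Φ j)) (hR : IsSEP S Φ Ψ R)
    (hg : IsGhostFlow W Φ Ψ R g) (hE : SEPEvolves (laxOp W V) Φ Ψ R)
    (s m j : ℕ) (hs : 1 ≤ s) (hm : 1 ≤ m) :
    (g s * mrFlow S m - (-1 : ℤ) ^ (s * m) • (mrFlow S m * g s)) (Φ j) = 0 := by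
  have he := mrFlow_isFlow S m hm
  change g s (mrFlow S m (Φ j)) - (-1 : ℤ) ^ (s * m) • mrFlow S m (g s (Φ j)) = 0
  rw [sub_eq_zero, (hΦ j).mrFlow m hm,
    flow_applyPos (hg.isFlow s hs) (hW.parityInv_laxOp_pow m),
    hW.map_laxOp_pow (hg.isFlow s hs) (hg.dressing s hs) m, applyPos_sub_left,
    applyPos_zsmul_left, applyPos_ghostOp_mul, applyPos_mul_ghostOp hR, hg.eigen s j hs,
    map_sub, (hΦ (s + j)).mrFlow m hm]
  have h1 : (laxOp W V ^ m).applyPos (ghostApply Φ R s j - Φ (s + j)) =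
      ∑ k ∈ Finset.range s, (laxOp W V ^ m).applyPos (Φ (s - 1 - k) * R k j) -
        (laxOp W V ^ m).applyPos (Φ (s + j)) := by
    change applyPosHom (laxOp W V ^ m) _ = _
    rw [map_sub, ghostApply, map_sum]; rfl
  -- The normalization of `R` enters here: its derivatives are the residues found in
  -- `applyPos_ghostOp_mul`.
  have h2 : (-1 : ℤ) ^ (s * m) • mrFlow S m (ghostApply Φ R s j) =
      (-1 : ℤ) ^ (s * m) • ∑ k ∈ Finset.range s,
        (laxOp W V ^ m).applyPos (Φ (s - 1 - k)) * R k j +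
      ∑ k ∈ Finset.range s, Φ (s - 1 - k) *
        (dpow S (-1) * C S (Ψ k) * laxOp W V ^ m * C S (Φ j) * dpow S (-1)).res := by
    rw [ghostApply, map_sum, Finset.smul_sum, Finset.smul_sum, ← Finset.sum_add_distrib]
    refine Finset.sum_congr rfl fun k hk => ?_
    have hk := Finset.mem_range.1 hk
    rw [he.mul, (hΦ _).mrFlow m hm, gradeInv_pow_of_eq 𝒢 (gradeInv_of_mem 𝒢 (hΦ _).parity),
      hE.mrFlow k j m hm, smul_add, smul_mul_smul_comm, smul_smul, ← pow_add, ← pow_add]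
    congr 1
    -- The signs from passing the flow over `Φ_a` and from the derivative of `R` add up to `(-1)^(m
    -- (a + k + 1)) = (-1)^(s m)`, which the prefactor cancels.
    rw [Even.neg_one_pow, one_smul]
    obtain ⟨a, rfl⟩ : ∃ a, s = a + k + 1 := ⟨s - 1 - k, by omega⟩
    have e : a + k + 1 - 1 - k = a := by omega
    rw [e]
    grind
  simp only [h1, Finset.sum_sub_distrib, smul_sub, h2]
  abel

theorem coAction_ghostOp_mul (hR : IsSEP S Φ Ψ R) (Q : SPDO S) (s j : ℕ) :
    (dpow S (-1) * C S (Ψ j) * (ghostOp S Φ Ψ s * Q)).res = ∑ k ∈ Finset.range s,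
      (R j (s - 1 - k) * coAction Q (Ψ k) -
        (-1 : ℤ) ^ (j + (s - 1 - k) + 1) • coAction Q (R j (s - 1 - k) * Ψ k)) := by
  rw [ghostOp, Finset.sum_mul, Finset.mul_sum, res_sum]
  refine Finset.sum_congr rfl fun k _ => ?_
  have h : dpow S (-1) * C S (Ψ j) * (C S (Φ (s - 1 - k)) * dpow S (-1) * C S (Ψ k) * Q) =
      C S (R j (s - 1 - k)) * (dpow S (-1) * C S (Ψ k) * Q) -
        (-1 : ℤ) ^ (j + (s - 1 - k) + 1) • (dpow S (-1) * C S (R j (s - 1 - k) * Ψ k) * Q) := by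
    calc _ = dpow S (-1) * C S (Ψ j) * C S (Φ (s - 1 - k)) * dpow S (-1) * (C S (Ψ k) * Q) := by
          noncomm_ring
      _ = _ := by
        rw [Dinv_mul_mul_Dinv hR, gradeInv_sep hR, C_zsmul, ← C_mul_C, sub_mul, mul_smul_comm,
          smul_mul_assoc]
        simp only [mul_assoc]
  rw [h, res_sub, res_zsmul, res_C_mul]
  rfl

theorem coAction_mul_ghostOp (hΨ : ∀ j : ℕ, Ψ j ∈ 𝒢 j) (Q : SPDO S) (s j : ℕ) :
    (dpow S (-1) * C S (Ψ j) * (Q * ghostOp S Φ Ψ s)).res = ∑ k ∈ Finset.range s,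
      (-1 : ℤ) ^ k • ((dpow S (-1) * C S (Ψ j) * Q * C S (Φ (s - 1 - k)) * dpow S (-1)).res *
        Ψ k) := by
  rw [ghostOp, Finset.mul_sum, Finset.mul_sum, res_sum]
  refine Finset.sum_congr rfl fun k _ => ?_
  rw [← mul_smul_comm, ← gradeInv_of_mem 𝒢 (hΨ k), ← res_mul_C]
  congr 1
  noncomm_ring

/-- The ghost flows supercommute with the Manin-Radul flows on the adjoint eigenfunctions. -/
theorem bracket_ghostFlow_mrFlow_adjEigen [CharZero 𝕜] (hW : IsMRSKP W V)
    (hΨ : ∀ j : ℕ, IsAdjSEF (laxOp W V) j (Ψ j)) (hR : IsSEP S Φ Ψ R)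
    (hg : IsGhostFlow W Φ Ψ R g) (hE : SEPEvolves (laxOp W V) Φ Ψ R)
    (s m j : ℕ) (hs : 1 ≤ s) (hm : 1 ≤ m) :
    (g s * mrFlow S m - (-1 : ℤ) ^ (s * m) • (mrFlow S m * g s)) (Ψ j) = 0 := by
  have he := mrFlow_isFlow S m hm
  have hgs := hg.isFlow s hs
  set Q := laxOp W V ^ m with hQ
  have hΨm : ∀ j, mrFlow S m (Ψ j) = (-1 : ℤ) ^ (j * m + j + m + 1) • coAction Q (Ψ j) :=
    fun j => by
      rw [(hΨ j).mrFlow_eq_res hW m hm, pow_succ _ (_ + m), mul_neg_one, neg_smul]; rfl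
  have hgΨ : g s (Ψ j) = ∑ k ∈ Finset.range s, (-1 : ℤ) ^ ((s - 1 - k) + j * (s + 1) + 1) •
      (R j (s - 1 - k) * Ψ k) + (-1 : ℤ) ^ (s * j) • Ψ (s + j) := by
    rw [hg.adjEigen s j hs, ghostAdjApply_eq hR fun j => (hΨ j).parity, ← Finset.sum_neg_distrib]
    simp only [pow_succ _ (_ + _ * _), mul_neg_one, neg_smul]
  have h1 : g s (coAction Q (Ψ j)) = (-1 : ℤ) ^ s • coAction Q (g s (Ψ j)) +
      (-1 : ℤ) ^ (s * (1 + j)) • ((dpow S (-1) * C S (Ψ j) * (ghostOp S Φ Ψ s * Q)).res -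
        (-1 : ℤ) ^ (s * m) • (dpow S (-1) * C S (Ψ j) * (Q * ghostOp S Φ Ψ s)).res) := by
    rw [coAction_apply, ← res_map, map_op_mul hgs, map_op_mul hgs, map_dpow hgs, zero_mul, zero_add,
      map_C, parityInv_pow_of_eq (parityInv_mul_of_eq parityInv_Dinv
        (parityInv_C_of_mem (hΨ j).parity)), parityInv_pow_of_eq parityInv_Dinv,
      hW.map_laxOp_pow hgs (hg.dressing s hs) m, coAction_apply]
    simp only [mul_one, smul_mul_assoc, res_add, res_zsmul, mul_sub, mul_smul_comm, res_sub,
      smul_sub, hQ]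
    rw [smul_comm ((-1 : ℤ) ^ (s * m))]
  -- The terms `coAction Q (R Ψ)` from the flow of `Ψ_j` cancel those from integrating by parts in
  -- `M_s Q`.
  have h2 : (-1 : ℤ) ^ s • coAction Q (g s (Ψ j)) +
      (-1 : ℤ) ^ (s * (1 + j)) • (dpow S (-1) * C S (Ψ j) * (ghostOp S Φ Ψ s * Q)).res =
      (-1 : ℤ) ^ (s * (1 + j)) • ∑ k ∈ Finset.range s, R j (s - 1 - k) * coAction Q (Ψ k) +
        (-1 : ℤ) ^ (s * (1 + j)) • coAction Q (Ψ (s + j)) := by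
    rw [hgΨ, map_add, map_zsmul, map_sum, coAction_ghostOp_mul hR, smul_add, smul_smul, ← pow_add,
      show s + s * j = s * (1 + j) by ring, Finset.smul_sum, Finset.smul_sum, Finset.smul_sum,
      add_right_comm, ← Finset.sum_add_distrib]
    congr 1
    refine Finset.sum_congr rfl fun k hk => ?_
    have hk := Finset.mem_range.1 hk
    obtain ⟨a, rfl⟩ : ∃ a, s = a + k + 1 := ⟨s - 1 - k, by omega⟩
    have e : a + k + 1 - 1 - k = a := by omega
    rw [e, map_zsmul, smul_sub, smul_smul, smul_smul, ← pow_add, ← pow_add, add_sub_assoc', add_comm,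
      add_sub_assoc, sign_smul_congr (m := a + k + 1 + (a + j * (a + k + 1 + 1) + 1))
        (n := (a + k + 1) * (1 + j) + (j + a + 1)) (by grind), sub_self, add_zero]
  -- The residues in the second sum come from the normalization of `R`; they match
  -- `coAction_mul_ghostOp`.
  have h3 : (-1 : ℤ) ^ (s * m) • mrFlow S m (g s (Ψ j)) =
      (-1 : ℤ) ^ (j * m + j + m + 1 + s * (1 + j)) •
        ∑ k ∈ Finset.range s, R j (s - 1 - k) * coAction Q (Ψ k) +
      (-1 : ℤ) ^ (j * m + j + m + s * (1 + j) + s * m) • ∑ k ∈ Finset.range s, (-1 : ℤ) ^ k •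
        ((dpow S (-1) * C S (Ψ j) * Q * C S (Φ (s - 1 - k)) * dpow S (-1)).res * Ψ k) +
      (-1 : ℤ) ^ (j * m + j + m + 1 + s * (1 + j)) • coAction Q (Ψ (s + j)) := by
    rw [hgΨ, map_add, map_zsmul, map_sum, hΨm, smul_add, smul_smul, smul_smul, ← pow_add,
      ← pow_add]
    congr 1
    · rw [Finset.smul_sum, Finset.smul_sum, Finset.smul_sum, ← Finset.sum_add_distrib]
      refine Finset.sum_congr rfl fun k hk => ?_
      have hk := Finset.mem_range.1 hk
      obtain ⟨a, rfl⟩ : ∃ a, s = a + k + 1 := ⟨s - 1 - k, by omega⟩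
      have e : a + k + 1 - 1 - k = a := by omega
      rw [e, map_zsmul, he.mul, gradeInv_pow_of_eq 𝒢 (gradeInv_sep hR j a), hE.mrFlow j a m hm,
        hΨm, smul_mul_assoc, smul_mul_smul_comm, smul_add, smul_add]
      simp only [smul_smul, ← pow_add]
      rw [add_comm]
      congr 1 <;> exact sign_smul_congr (by grind) _
    · exact sign_smul_congr (by grind) _
  change g s (mrFlow S m (Ψ j)) - (-1 : ℤ) ^ (s * m) • mrFlow S m (g s (Ψ j)) = 0
  rw [sub_eq_zero, h3, hΨm, map_zsmul, h1, smul_sub, ← add_sub_assoc, h2, coAction_mul_ghostOp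
    fun j => (hΨ j).parity]
  simp only [smul_sub, smul_add, smul_smul, ← pow_add]
  rw [sign_smul_congr (m := j * m + j + m + s * (1 + j) + s * m)
    (n := j * m + j + m + 1 + (s * (1 + j) + s * m) + 1) (by grind), pow_succ _ (_ + _ + (_ + _)),
    mul_neg_one, neg_smul]
  abel

/-- The algebra of the ghost flows on the eigenfunctions. -/
theorem bracket_ghostFlow_ghostFlow_eigen (hΦ : ∀ j : ℕ, Φ j ∈ 𝒢 j)
    (hg : IsGhostFlow W Φ Ψ R g) (hE : SEPGhostEvolves R g) (s t j : ℕ) (hs : 1 ≤ s)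
    (ht : 1 ≤ t) : (g s * g t - (-1 : ℤ) ^ (s * t) • (g t * g s)
      + (1 - (-1 : ℤ) ^ (s * t)) • g (s + t)) (Φ j) = 0 := by
  -- The two double sums are exchanged, up to bound variables, when `s` and `t` are swapped, so they
  -- drop out of the supercommutator. The shift terms are left to `sum_range_splice`.
  have key : ∀ s t, 1 ≤ s → 1 ≤ t → g s (g t (Φ j)) =
      ∑ d ∈ Finset.range t, ∑ b ∈ Finset.range s, Φ (s - 1 - b) * R b (t - 1 - d) * R d j
      - ∑ d ∈ Finset.range t, Φ (s + (t - 1 - d)) * R d j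
      + (-1 : ℤ) ^ (s * t) • (∑ b ∈ Finset.range s, ∑ d ∈ Finset.range t,
          Φ (t - 1 - d) * R d (s - 1 - b) * R b j
        - ghostApply Φ R t (s + j) + ∑ d ∈ Finset.range t, Φ (t - 1 - d) * R (s + d) j)
      - (ghostApply Φ R s (t + j) - Φ (s + t + j)) := by
    intro s t hs ht
    rw [hg.eigen t j ht, map_sub, hg.eigen s (t + j) hs, add_assoc s t j, ghostApply, map_sum]
    congr 1
    rw [Finset.sum_comm (s := Finset.range s), ghostApply, ← Finset.sum_sub_distrib,
      ← Finset.sum_sub_distrib, ← Finset.sum_add_distrib, Finset.smul_sum, ← Finset.sum_add_distrib]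
    refine Finset.sum_congr rfl fun d hd => ?_
    have hd := Finset.mem_range.1 hd
    rw [(hg.isFlow s hs).mul, gradeInv_pow_of_eq 𝒢 (gradeInv_of_mem 𝒢 (hΦ _)), hE s d j hs,
      smul_mul_smul_comm, ← pow_add, hg.eigen s _ hs, ghostApply, sub_mul, Finset.sum_mul]
    congr 1
    simp only [mul_sub, mul_add, Finset.mul_sum, mul_assoc]
    refine sign_smul_congr ?_ _
    obtain ⟨c, rfl⟩ : ∃ c, t = c + d + 1 := ⟨t - 1 - d, by omega⟩
    have e : c + d + 1 - 1 - d = c := by omega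
    rw [e]
    grind
  have h1 := sum_range_splice (fun i k => Φ i * R k j) s t
  have h2 := sum_range_splice (fun i k => Φ i * R k j) t s
  have e := neg_one_pow_mul_self (s * t)
  change g s (g t (Φ j)) - (-1 : ℤ) ^ (s * t) • g t (g s (Φ j)) +
    (1 - (-1 : ℤ) ^ (s * t)) • g (s + t) (Φ j) = 0
  rw [add_comm t s] at h2
  change _ = ghostApply Φ R (s + t) j at h1 h2
  rw [key s t hs ht, key t s ht hs, mul_comm t s, add_comm t s, hg.eigen (s + t) j (by omega),
    sub_smul, one_smul]
  conv_lhs => enter [2, 1]; rw [← h1]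
  rw [← h2]
  simp only [smul_add, smul_sub, smul_smul, e, one_smul]
  abel

/-- The algebra of the ghost flows on the adjoint eigenfunctions. -/
theorem bracket_ghostFlow_ghostFlow_adjEigen (hR : IsSEP S Φ Ψ R) (hΨ : ∀ j : ℕ, Ψ j ∈ 𝒢 j)
    (hg : IsGhostFlow W Φ Ψ R g) (hE : SEPGhostEvolves R g) (s t j : ℕ) (hs : 1 ≤ s)
    (ht : 1 ≤ t) : (g s * g t - (-1 : ℤ) ^ (s * t) • (g t * g s)
      + (1 - (-1 : ℤ) ^ (s * t)) • g (s + t)) (Ψ j) = 0 := by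
  have hgΨ : ∀ s j, 1 ≤ s → g s (Ψ j) = (-1 : ℤ) ^ (j * (s + 1) + 1) • ∑ k ∈ Finset.range s,
      (-1 : ℤ) ^ (s - 1 - k) • (R j (s - 1 - k) * Ψ k) + (-1 : ℤ) ^ (s * j) • Ψ (s + j) := by
    intro s j hs
    rw [hg.adjEigen s j hs, ghostAdjApply_eq hR hΨ, pow_succ _ (_ * _), mul_neg_one, neg_smul,
      Finset.smul_sum]
    congr 2
    refine Finset.sum_congr rfl fun k _ => ?_
    rw [smul_smul, ← pow_add, add_comm]
  -- As for `Φ`, the cubic double sums are arranged so that swapping `s` and `t` interchanges them.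
  have key : ∀ s t, 1 ≤ s → 1 ≤ t → g s (g t (Ψ j)) =
      (-1 : ℤ) ^ (j * (s + t + 1)) • (
        (-1 : ℤ) ^ (s + 1) • ∑ d ∈ Finset.range t, ∑ b ∈ Finset.range s,
          (-1 : ℤ) ^ (t - 1 - d) • (R j (s - 1 - b) * R b (t - 1 - d) * Ψ d)
        + (-1 : ℤ) ^ (t + s * t + 1) • ∑ b ∈ Finset.range s, ∑ d ∈ Finset.range t,
          (-1 : ℤ) ^ (s - 1 - b) • (R j (t - 1 - d) * R d (s - 1 - b) * Ψ b)
        + ∑ d ∈ Finset.range t, (-1 : ℤ) ^ (s + (t - 1 - d)) • (R j (s + (t - 1 - d)) * Ψ d)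
        + (-1 : ℤ) ^ (s + 1) • ∑ d ∈ Finset.range t,
          (-1 : ℤ) ^ (t - 1 - d) • (R (s + j) (t - 1 - d) * Ψ d)
        + (-1 : ℤ) ^ (t + s * t + 1) • ∑ b ∈ Finset.range s,
          (-1 : ℤ) ^ (s - 1 - b) • (R (t + j) (s - 1 - b) * Ψ b)
        + (-1 : ℤ) ^ (s * t + 1) • ∑ d ∈ Finset.range t,
          (-1 : ℤ) ^ (t - 1 - d) • (R j (t - 1 - d) * Ψ (s + d)))
      + (-1 : ℤ) ^ ((s + t) * j + s * t) • Ψ (s + t + j) := by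
    intro s t hs ht
    have h1 : ∀ d ∈ Finset.range t, g s ((-1 : ℤ) ^ (t - 1 - d) • (R j (t - 1 - d) * Ψ d)) =
        (-1 : ℤ) ^ (s * (j + 1)) • ∑ b ∈ Finset.range s,
          (-1 : ℤ) ^ (t - 1 - d) • (R j (s - 1 - b) * R b (t - 1 - d) * Ψ d)
        + (-1 : ℤ) ^ (s * j + 1) • (-1 : ℤ) ^ (s + (t - 1 - d)) •
          (R j (s + (t - 1 - d)) * Ψ d)
        + (-1 : ℤ) ^ (s * (j + 1)) •
          (-1 : ℤ) ^ (t - 1 - d) • (R (s + j) (t - 1 - d) * Ψ d)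
        + (-1 : ℤ) ^ (s * j + t + s * t) • ∑ b ∈ Finset.range s,
          (-1 : ℤ) ^ (s - 1 - b) • (R j (t - 1 - d) * R d (s - 1 - b) * Ψ b)
        + (-1 : ℤ) ^ (s * j + s * t) •
          (-1 : ℤ) ^ (t - 1 - d) • (R j (t - 1 - d) * Ψ (s + d)) := by
      intro d hd
      have hd := Finset.mem_range.1 hd
      obtain ⟨c, rfl⟩ : ∃ c, t = c + d + 1 := ⟨t - 1 - d, by omega⟩
      have e : c + d + 1 - 1 - d = c := by omega
      rw [e, map_zsmul, (hg.isFlow s hs).mul, hE s j c hs,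
        gradeInv_pow_of_eq 𝒢 (gradeInv_sep hR j c), hgΨ s d hs, pow_succ _ (s * j), mul_neg_one,
        neg_smul, ← sub_eq_add_neg]
      simp only [smul_mul_assoc, mul_add, add_mul, sub_mul, smul_add, smul_sub, mul_smul_comm,
        Finset.sum_mul, Finset.mul_sum, Finset.smul_sum, smul_smul, ← pow_add, mul_assoc]
      rw [← add_assoc]
      refine congrArg₂ _ (congrArg₂ _ (congrArg₂ _ (congrArg₂ _
        (Finset.sum_congr rfl fun b _ => ?_) ?_) ?_) (Finset.sum_congr rfl fun b _ => ?_)) ?_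
      all_goals exact sign_smul_congr (by grind) _
    have h2 : ∀ (a b c e : ℤ) (x y z u v : ℕ → A),
        ∑ d ∈ Finset.range t, (a • x d + b • y d + a • z d + c • u d + e • v d) =
        a • ∑ d ∈ Finset.range t, x d + b • ∑ d ∈ Finset.range t, y d +
          a • ∑ d ∈ Finset.range t, z d + c • ∑ d ∈ Finset.range t, u d +
          e • ∑ d ∈ Finset.range t, v d := fun a b c e x y z u v => by
      simp only [Finset.sum_add_distrib, Finset.smul_sum]
    have h3 := (Finset.sum_congr rfl h1).trans (h2 _ _ _ _ _ _ _ _ _)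
    rw [Finset.sum_comm (s := Finset.range t) (t := Finset.range s)
      (f := fun d b => (-1 : ℤ) ^ (s - 1 - b) • (R j (t - 1 - d) * R d (s - 1 - b) * Ψ b))] at h3
    rw [hgΨ t j ht, map_add, map_zsmul, map_zsmul, map_sum, h3, hgΨ s (t + j) hs, add_assoc s t j]
    generalize (∑ d ∈ Finset.range t, ∑ b ∈ Finset.range s, _ : A) = x₁
    generalize (∑ b ∈ Finset.range s, ∑ d ∈ Finset.range t, _ : A) = x₂
    generalize (∑ d ∈ Finset.range t,
      (-1 : ℤ) ^ (s + (t - 1 - d)) • (R j (s + (t - 1 - d)) * Ψ d) : A) = x₃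
    generalize (∑ d ∈ Finset.range t,
      (-1 : ℤ) ^ (t - 1 - d) • (R (s + j) (t - 1 - d) * Ψ d) : A) = x₄
    generalize (∑ b ∈ Finset.range s,
      (-1 : ℤ) ^ (s - 1 - b) • (R (t + j) (s - 1 - b) * Ψ b) : A) = x₅
    generalize (∑ d ∈ Finset.range t,
      (-1 : ℤ) ^ (t - 1 - d) • (R j (t - 1 - d) * Ψ (s + d)) : A) = x₆
    -- With the sums opaque, only signs remain; they depend on the parities of `s`, `t`, `j`, which
    -- leaves eight linear identities.
    rcases neg_one_pow_eq_or ℤ s with h₁ | h₁ <;> rcases neg_one_pow_eq_or ℤ t with h₂ | h₂ <;>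
    rcases neg_one_pow_eq_or ℤ j with h₃ | h₃ <;>
    · simp only [mul_add, add_mul, pow_add, pow_mul, h₁, h₂, h₃, one_pow, pow_one, mul_one,
        mul_neg, neg_neg, one_smul, neg_smul, smul_add, smul_neg]
      abel
  have h1 := sum_range_splice (fun i k => (-1 : ℤ) ^ i • (R j i * Ψ k)) s t
  have h2 := sum_range_splice (fun i k => (-1 : ℤ) ^ i • (R j i * Ψ k)) t s
  rw [add_comm t s, ← eq_sub_iff_add_eq'] at h2
  rw [← eq_sub_iff_add_eq'] at h1
  change g s (g t (Ψ j)) - (-1 : ℤ) ^ (s * t) • g t (g s (Ψ j)) +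
    (1 - (-1 : ℤ) ^ (s * t)) • g (s + t) (Ψ j) = 0
  rw [key s t hs ht, key t s ht hs, mul_comm t s, add_comm t s, hgΨ (s + t) j (by omega), h1, h2]
  generalize (∑ d ∈ Finset.range t, ∑ b ∈ Finset.range s, _ : A) = x₁
  generalize (∑ b ∈ Finset.range s, ∑ d ∈ Finset.range t, _ : A) = x₂
  generalize (∑ d ∈ Finset.range t,
    (-1 : ℤ) ^ (s + (t - 1 - d)) • (R j (s + (t - 1 - d)) * Ψ d) : A) = x₃
  generalize (∑ d ∈ Finset.range s,
    (-1 : ℤ) ^ (t + (s - 1 - d)) • (R j (t + (s - 1 - d)) * Ψ d) : A) = x₄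
  generalize (∑ d ∈ Finset.range t,
    (-1 : ℤ) ^ (t - 1 - d) • (R (s + j) (t - 1 - d) * Ψ d) : A) = x₅
  generalize (∑ d ∈ Finset.range s,
    (-1 : ℤ) ^ (s - 1 - d) • (R (t + j) (s - 1 - d) * Ψ d) : A) = x₆
  generalize (∑ d ∈ Finset.range (s + t),
    (-1 : ℤ) ^ (s + t - 1 - d) • (R j (s + t - 1 - d) * Ψ d) : A) = x₇
  rcases neg_one_pow_eq_or ℤ s with h₁ | h₁ <;> rcases neg_one_pow_eq_or ℤ t with h₂ | h₂ <;>
  rcases neg_one_pow_eq_or ℤ j with h₃ | h₃ <;>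
  · simp only [mul_add, add_mul, pow_add, pow_mul, h₁, h₂, h₃, one_pow, pow_one, mul_one,
      mul_neg, neg_neg, one_smul, neg_smul, smul_add, smul_neg, smul_sub, sub_smul]
    abel

end Eigenfunctions

/-! ### From supercommutators to commutators and anticommutators. -/

section Unified

variable {𝕜 A : Type*} [Field 𝕜] [Ring A] [Algebra 𝕜 A] {𝒢 : ZMod 2 → Submodule 𝕜 A}
  {g : ℕ → Module.End 𝕜 A} {Z : Module.End 𝕜 A → Prop}

theorem sign_even_left (k l : ℕ) : (-1 : ℤ) ^ (2 * k * l) = 1 := Even.neg_one_pow (by simp [mul_assoc])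

theorem sign_even_right (k l : ℕ) : (-1 : ℤ) ^ (l * (2 * k)) = 1 := Even.neg_one_pow (by simp)

theorem sign_odd_odd {k l : ℕ} (hk : 1 ≤ k) (hl : 1 ≤ l) :
    (-1 : ℤ) ^ ((2 * k - 1) * (2 * l - 1)) = -1 :=
  Odd.neg_one_pow ((odd_two_mul_sub_one hk).mul (odd_two_mul_sub_one hl))

theorem ghostCommute_of_bracket (S : Superspace 𝒢) (h : ∀ s m, 1 ≤ s → 1 ≤ m →
    Z (g s * mrFlow S m - (-1 : ℤ) ^ (s * m) • (mrFlow S m * g s))) : GhostCommute S g Z where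
  even_even k l hk hl := by
    have := h (2 * k) (2 * l) (by omega) (by omega)
    rwa [mrFlow_even, sign_even_left, one_smul] at this
  even_odd k n hk hn := by
    have := h (2 * k) (2 * n - 1) (by omega) (by omega)
    rwa [mrFlow_odd S hn, sign_even_left, one_smul] at this
  odd_even k l hk hl := by
    have := h (2 * k - 1) (2 * l) (by omega) (by omega)
    rwa [mrFlow_even, sign_even_right, one_smul] at this
  odd_odd k n hk hn := by
    have := h (2 * k - 1) (2 * n - 1) (by omega) (by omega)
    rwa [mrFlow_odd S hn, sign_odd_odd hk hn, neg_one_smul, sub_neg_eq_add] at this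

/-- The correction `1 - (-1)^(s t)` is `0` unless both indices are odd, where it is `2` and `(2i-1)
+ (2j-1) = 2(i+j-1)` yields the even flow on the right. -/
theorem ghostAlgebra_of_bracket (h : ∀ s t, 1 ≤ s → 1 ≤ t →
    Z (g s * g t - (-1 : ℤ) ^ (s * t) • (g t * g s) + (1 - (-1 : ℤ) ^ (s * t)) • g (s + t))) :
    GhostAlgebra g Z where
  even_even k l hk hl := by
    have := h (2 * k) (2 * l) (by omega) (by omega)
    rwa [sign_even_left, one_smul, sub_self, zero_smul, add_zero] at this
  even_odd k n hk hn := by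
    have := h (2 * k) (2 * n - 1) (by omega) (by omega)
    rwa [sign_even_left, one_smul, sub_self, zero_smul, add_zero] at this
  odd_odd i j hi hj := by
    have := h (2 * i - 1) (2 * j - 1) (by omega) (by omega)
    have e : 2 * i - 1 + (2 * j - 1) = 2 * (i + j - 1) := by omega
    have e2 : (1 - -1 : ℤ) • g (2 * (i + j - 1)) = (2 : 𝕜) • g (2 * (i + j - 1)) := by
      rw [two_smul 𝕜, sub_neg_eq_add, one_add_one_eq_two, two_zsmul]
    have e3 : -(2 : 𝕜) • g (2 * (i + j - 1)) = -((2 : 𝕜) • g (2 * (i + j - 1))) :=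
      LinearMap.ext fun x => neg_smul (2 : 𝕜) (g (2 * (i + j - 1)) x)
    rw [e3, sub_neg_eq_add]
    rwa [sign_odd_odd hi hj, neg_one_smul, sub_neg_eq_add, e, e2] at this

end Unified

end

theorem proposition1 {𝕜 A : Type*} [Field 𝕜] [CharZero 𝕜] [Ring A] [Algebra 𝕜 A]
    (𝒢 : ZMod 2 → Submodule 𝕜 A) [GradedAlgebra 𝒢] (S : Superspace 𝒢)
    (W V L : SPDO S) (hW : IsMRSKP W V) (hL : L = laxOp W V)
    (Φ Ψ : ℕ → A) (hΦ : ∀ j : ℕ, IsSEF L j (Φ j)) (hΨ : ∀ j : ℕ, IsAdjSEF L j (Ψ j))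
    (R : ℕ → ℕ → A) (hR : IsSEP S Φ Ψ R)
    (M : ℕ → SPDO S) (hM : ∀ s, M s = ghostOp S Φ Ψ s)
    (g : ℕ → Module.End 𝕜 A) (hg : IsGhostFlow W Φ Ψ R g) :
    -- the flows on the dressing operator and on the Lax operator
    GhostCommute S g (fun f => W.map f = 0 ∧ L.map f = 0) ∧
    GhostAlgebra g (fun f => W.map f = 0 ∧ L.map f = 0) ∧
    -- the equations for `M` along the ordinary flows
    (∀ k s, 1 ≤ k → 1 ≤ s → (M s).map (S.dt k) = (SPDO.comm (L ^ (2 * k)).pos (M s)).neg) ∧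
    (∀ n k, 1 ≤ n → 1 ≤ k →
      (M (2 * k)).map (S.dD n) = (SPDO.comm (L ^ (2 * n - 1)).pos (M (2 * k))).neg) ∧
    (∀ n k, 1 ≤ n → 1 ≤ k →
      (M (2 * k - 1)).map (S.dD n) = (SPDO.anticomm (L ^ (2 * n - 1)).pos (M (2 * k - 1))).neg) ∧
    -- the equations for `M` along the ghost flows
    (∀ k l, 1 ≤ k → 1 ≤ l → (M (2 * l)).map (g (2 * k)) - (M (2 * k)).map (g (2 * l))
      - SPDO.comm (M (2 * k)) (M (2 * l)) = 0) ∧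
    (∀ k l, 1 ≤ k → 1 ≤ l → (M (2 * l - 1)).map (g (2 * k)) - (M (2 * k)).map (g (2 * l - 1))
      - SPDO.comm (M (2 * k)) (M (2 * l - 1)) = 0) ∧
    (∀ k l, 1 ≤ k → 1 ≤ l →
      (M (2 * l - 1)).map (g (2 * k - 1)) + (M (2 * k - 1)).map (g (2 * l - 1))
        - SPDO.anticomm (M (2 * k - 1)) (M (2 * l - 1)) = - ((2 : ℤ) • M (2 * (k + l - 1)))) ∧
    -- the flows on the (adjoint) eigenfunctions, for consistently normalized potentials
    (SEPEvolves L Φ Ψ R → GhostCommute S g (fun f => ∀ j, f (Φ j) = 0 ∧ f (Ψ j) = 0)) ∧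
    (SEPGhostEvolves R g → GhostAlgebra g (fun f => ∀ j, f (Φ j) = 0 ∧ f (Ψ j) = 0)) := by
  subst hL
  obtain rfl : M = ghostOp S Φ Ψ := funext hM
  have hΦ' : ∀ j : ℕ, Φ j ∈ 𝒢 j := fun j => (hΦ j).parity
  have hΨ' : ∀ j : ℕ, Ψ j ∈ 𝒢 j := fun j => (hΨ j).parity
  refine ⟨ghostCommute_of_bracket S fun s m hs hm => ?_, ghostAlgebra_of_bracket fun s t hs ht => ?_,
    fun k s hk hs => ?_, fun n k hn hk => ?_, fun n k hn hk => ?_, fun k l hk hl => ?_,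
    fun k l hk hl => ?_, fun k l hk hl => ?_,
    fun hE => ghostCommute_of_bracket S fun s m hs hm j => ⟨?_, ?_⟩,
    fun hE => ghostAlgebra_of_bracket fun s t hs ht j => ⟨?_, ?_⟩⟩
  · have h := map_bracket_ghostFlow_mrFlow hW hΦ hΨ hg s m hs hm
    exact ⟨h, hW.map_laxOp_eq_zero ((hg.isFlow s hs).bracket (mrFlow_isFlow S m hm)) h⟩
  · have h := map_bracket_ghostFlow_ghostFlow hR hg hΦ' hΨ' s t hs ht
    -- The correction `g (s + t)` has the same parity as the bracket, so their sum is still a flow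
    -- and the vanishing on `W` passes to `L`.
    exact ⟨h, hW.map_laxOp_eq_zero (((hg.isFlow s hs).bracket (hg.isFlow t ht)).add
      ((hg.isFlow (s + t) (by omega)).zsmul _)) h⟩
  · have h := map_mrFlow_ghostOp hW hΦ hΨ (2 * k) s (by omega)
    rwa [mrFlow_even, sign_even_left, one_smul] at h
  · have h := map_mrFlow_ghostOp hW hΦ hΨ (2 * n - 1) (2 * k) (by omega)
    rwa [mrFlow_odd S hn, sign_even_right, one_smul] at h
  · have h := map_mrFlow_ghostOp hW hΦ hΨ (2 * n - 1) (2 * k - 1) (by omega)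
    rwa [mrFlow_odd S hn, sign_odd_odd hn hk, neg_one_smul, sub_neg_eq_add] at h
  · have h := ghostFlow_zero_curvature hR hg hΦ' hΨ' (2 * k) (2 * l) (by omega) (by omega)
    rwa [sign_even_left, one_smul, one_smul, sub_self 1, zero_smul] at h
  · have h := ghostFlow_zero_curvature hR hg hΦ' hΨ' (2 * k) (2 * l - 1) (by omega) (by omega)
    rwa [sign_even_left, one_smul, one_smul, sub_self 1, zero_smul] at h
  · have h := ghostFlow_zero_curvature hR hg hΦ' hΨ' (2 * k - 1) (2 * l - 1) (by omega) (by omega)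
    have e : 2 * k - 1 + (2 * l - 1) = 2 * (k + l - 1) := by omega
    rwa [sign_odd_odd hk hl, neg_one_smul, neg_one_smul, sub_neg_eq_add, sub_neg_eq_add, e,
      show (-1 - 1 : ℤ) = -2 by norm_num, neg_smul] at h
  · exact bracket_ghostFlow_mrFlow_eigen hW hΦ hR hg hE s m j hs hm
  · exact bracket_ghostFlow_mrFlow_adjEigen hW hΨ hR hg hE s m j hs hm
  · exact bracket_ghostFlow_ghostFlow_eigen hΦ' hg hE s t j hs ht
  · exact bracket_ghostFlow_ghostFlow_adjEigen hR hΨ' hg hE s t j hs ht
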